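/- Let $w:\{1,2,\dots\}\to(0,\infty)$ and let $\mathcal G$ be a locally finite graph (possibly with multiple edges). The edge-reinforced random walk (ERRW) on $\mathcal G$ with reinforcement weight function $w$, initial edge weights equal to $1$ and a given initial vertex $v_0$ is the nearest-neighbour process which starts at $v_0$ at the initial time $t_0$ (here $t_0$ is the number of edges of $\mathcal G$ if $\mathcal G$ is finite, and $t_0=0$ if $\mathcal G$ is infinite) and which, given its past up to time $n\ge t_0$, traverses next an edge $e$ incident to its current vertex $v$ with probability $$\frac{w(X_n^{e})}{\sum_{f\ni v} w(X_n^{f})},\qquad X_n^{e}=1+\#\{\text{traversals of } e \text{ before time } n\}.$$ Let $T$ be the first time $k\ge t_0$ such that from time $k$ on only one single edge is traversed ($T=\infty$ if there is none). Write $P^{\mathcal G}$ for the law of the ERRW on $\mathcal G$, and $P^{1,1}$ for its law on the graph consisting of two vertices joined by two parallel edges (so that $t_0=2$). Let $\rho>1$, $\rho'=(\rho-1)/\rho$, and suppose that either (a) $w(k)=k^{\rho}$ for all $k\ge 1$, or (b) for some $\alpha>0$, $w(k)=k^{\rho}\log^{\alpha}k$ for all $k\ge 2$, and $w(1)>0$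 is arbitrary. Let $\mathcal G$ be an infinite tree of bounded degree and let $v_0$ be any vertex of $\mathcal G$. Then, for every $q>\rho-\rho'$, $$P^{\mathcal G}(T>k)=P^{1,1}(T>k)\cdot O(\log^{q}k)\qquad (k\to\infty).$$ -/

import Mathlib

open MeasureTheory ProbabilityTheory Filter Asymptotics

/-! Edge-reinforced random walks on (multi)graphs.

A multigraph with vertex type `V` and edge type `E` is given by the map `ends : E → Sym2 V` that
sends an edge to its pair of endpoints.  A simple graph `G` is the case `E = G.edgeSet`, with `ends`
the inclusion into `Sym2 V`.

A trajectory is recorded by the positions `I n` (the vertex occupied after `n` steps) and by the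
edges `Y n` (the edge traversed in the step from `I n` to `I (n + 1)`). -/

namespace ReinforcedWalk

variable {V E Ω : Type*}

open Classical in
/-- The current weight of `e` after `n` steps: the initial weight `ℓ₀ e` plus the number of
traversals of `e` during the first `n` steps. -/
noncomputable def edgeWeight (ℓ₀ : E → ℕ) (Y : ℕ → Ω → E) (n : ℕ) (e : E) (ω : Ω) : ℕ :=
  ℓ₀ e + ((Finset.range n).filter (fun i => Y i ω = e)).card

open Classical in
/-- The probability that the walk, given its first `n` steps, traverses the edge `e` next:
`w`-proportional to the current weight among the edges incident to the current position, and `0` for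
all other edges. -/
noncomputable def stepProb (ends : E → Sym2 V) (w : ℕ → ℝ) (ℓ₀ : E → ℕ)
    (I : ℕ → Ω → V) (Y : ℕ → Ω → E) (n : ℕ) (e : E) (ω : Ω) : ℝ :=
  if I n ω ∈ ends e then
    w (edgeWeight ℓ₀ Y n e ω) /
      ∑ᶠ (f : E) (_ : I n ω ∈ ends f), w (edgeWeight ℓ₀ Y n f ω)
  else 0

/-- The σ-algebra generated by the first `n` steps of the walk. -/
@[reducible] def past (I : ℕ → Ω → V) (Y : ℕ → Ω → E) (n : ℕ) : MeasurableSpace Ω :=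
  (⨆ (i : ℕ) (_ : i ≤ n), MeasurableSpace.comap (I i) ⊤) ⊔
    ⨆ (i : ℕ) (_ : i < n), MeasurableSpace.comap (Y i) ⊤

/-- `(I, Y)` is, under the probability measure `μ`, an edge-reinforced random walk with reinforcement
weight function `w`, initial edge weights `ℓ₀` and initial position `v₀`, on the locally finite
multigraph `ends`.  Time is counted from the first step. -/
structure IsERRW [MeasurableSpace Ω] (ends : E → Sym2 V) (w : ℕ → ℝ) (ℓ₀ : E → ℕ) (v₀ : V)
    (μ : Measure Ω) (I : ℕ → Ω → V) (Y : ℕ → Ω → E) : Prop where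
  isProbabilityMeasure : IsProbabilityMeasure μ
  measurable_position : ∀ n, Measurable[_, ⊤] (I n)
  measurable_edge : ∀ n, Measurable[_, ⊤] (Y n)
  start : ∀ᵐ ω ∂μ, I 0 ω = v₀
  step : ∀ n, ∀ᵐ ω ∂μ, ends (Y n ω) = s(I n ω, I (n + 1) ω)
  rule : ∀ n e, μ⟦Y n ⁻¹' {e} | past I Y n⟧ =ᵐ[μ] stepProb ends w ℓ₀ I Y n e

/-- The time of attraction `T`: the first time from which on a single edge is traversed (`⊤` if there
is none), for a walk whose first step is taken at the initial time `t₀`. -/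
noncomputable def attractionTime (t₀ : ℕ) (Y : ℕ → Ω → E) (ω : Ω) : ℕ∞ :=
  ⨅ (k : ℕ) (_ : ∀ n, k ≤ n → Y n ω = Y (n + 1) ω), ((t₀ + k : ℕ) : ℕ∞)

/-- The tail probability `P(T > k)`. -/
noncomputable def tail [MeasurableSpace Ω] (μ : Measure Ω) (t₀ : ℕ) (Y : ℕ → Ω → E) (k : ℕ) : ℝ :=
  μ.real {ω | (k : ℕ∞) < attractionTime t₀ Y ω}

/-- The endpoints of the edges of a simple graph. -/
def simpleEnds (G : SimpleGraph V) : G.edgeSet → Sym2 V := fun e => (e : Sym2 V)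

/-- The graph with two vertices `0` and `1` and two parallel edges (indexed by `Bool`). -/
def twoEdges : Bool → Sym2 (Fin 2) := fun _ => s(0, 1)

/-- The admissible reinforcement weights: `w k = k ^ ρ`, or `w k = k ^ ρ (log k) ^ α` with `α > 0`;
as `log 1 = 0`, the value `w 1` is in the second case an arbitrary positive number. -/
def IsPowerLogWeight (ρ : ℝ) (w : ℕ → ℝ) : Prop :=
  (∀ k : ℕ, 1 ≤ k → w k = (k : ℝ) ^ ρ) ∨
    ∃ α : ℝ, 0 < α ∧ 0 < w 1 ∧ ∀ k : ℕ, 2 ≤ k → w k = (k : ℝ) ^ ρ * Real.log k ^ α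

end ReinforcedWalk

open ReinforcedWalk

/-! Put `σ = (ρ - 1) / ρ`, and `α = 0` for pure powers. Both tails are compared with `g k = k ^ (1 +
σ - ρ) * (log k) ^ (-α)`: the two-edge tail is at least a constant times `g k`
(`isBigO_tail_twoEdges`), the tree tail at most a constant times `g k * (log k) ^ (ρ - 1)`
(`isBigO_tail_tree`). Since `σ ≤ 1`, the condition on `q` gives `ρ - 1 ≤ q`.

Two edges. The probability of being in a given state, suitably normalised, satisfies an averaging
recursion, so a minimum principle shows that the light edge has been used `j` times at time `k` with
probability at least of order `1 / w (j + 1)` (`exists_le_urnState`). If `j ≤ B` with `B` of order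
`k ^ σ`, the heavy edge is then followed for `t ≤ k` steps with probability at least `1 / 2`, and
left with probability at least of order `w (j + 1) / w (2 * k)`. The `B * k` choices of `(j, t)` are
disjoint and add up to order `B * k / w (2 * k)`, that is, `g k`.

Tree. Every edge is a bridge, so at visits to `v` the weight of an edge is determined by the number
of departures from `v` along it. Two edges at `v` thus compete almost like the two-edge walk, and a
maximum principle bounds the probability of leaving `v` along one edge when the other has weight at
least `K` (`IsERRW.measure_lateDepart_le`). Each newly found inner vertex offers a fresh edge on
which the walk stays forever with probability bounded below, so the number of inner vertices visited
has a geometric tail and finite mean. If only about `log k` of them are visited, then by pigeonhole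
some edge has weight of order `k / log k` at time `k`, and a later change of edge forces such a
departure. Summing over `v` gives `IsERRW.exists_tail_le`; the loss of `log k` in the weight becomes
the factor `(log k) ^ (ρ - 1)`. -/

namespace ReinforcedWalk

/-! ### Events of the past, edge weights and one-step probabilities. -/

section Basics

variable {V E Ω : Type*}

/-- There are only countably many histories of length `n`, so an event that depends on the history
alone is a countable union of cylinders. -/
lemma measurableSet_past_of_forall [Countable V] [Countable E] (I : ℕ → Ω → V) (Y : ℕ → Ω → E)
    (n : ℕ) (A : Set Ω)
    (h : ∀ ω ω', (∀ i ≤ n, I i ω = I i ω') → (∀ i < n, Y i ω = Y i ω') → ω ∈ A → ω' ∈ A) :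
    MeasurableSet[past I Y n] A := by
  let H : Ω → (Fin (n + 1) → V) × (Fin n → E) := fun ω => (fun i => I i ω, fun i => Y i ω)
  have hI : ∀ i, i ≤ n → ∀ v, MeasurableSet[past I Y n] (I i ⁻¹' {v}) := by
    intro i hi v
    have : MeasurableSpace.comap (I i) ⊤ ≤ past I Y n :=
      le_sup_of_le_left (le_iSup₂_of_le i hi le_rfl)
    exact this _ ⟨{v}, trivial, rfl⟩
  have hY : ∀ i, i < n → ∀ e, MeasurableSet[past I Y n] (Y i ⁻¹' {e}) := by
    intro i hi e
    have : MeasurableSpace.comap (Y i) ⊤ ≤ past I Y n :=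
      le_sup_of_le_right (le_iSup₂_of_le i hi le_rfl)
    exact this _ ⟨{e}, trivial, rfl⟩
  have hA : A = ⋃ x ∈ H '' A, ((⋂ i : Fin (n + 1), I i ⁻¹' {x.1 i}) ∩ ⋂ i : Fin n, Y i ⁻¹' {x.2 i}) := by
    ext ω
    simp only [Set.mem_iUnion, Set.mem_inter_iff, Set.mem_iInter, Set.mem_preimage,
      Set.mem_singleton_iff]
    constructor
    · intro hω
      exact ⟨H ω, ⟨ω, hω, rfl⟩, fun i => rfl, fun i => rfl⟩
    · rintro ⟨x, ⟨ω', hω', rfl⟩, h1, h2⟩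
      exact h ω' ω (fun i hi => (h1 ⟨i, by omega⟩).symm) (fun i hi => (h2 ⟨i, hi⟩).symm) hω'
  rw [hA]
  refine MeasurableSet.biUnion (Set.to_countable _) fun x _ => MeasurableSet.inter ?_ ?_
  · exact MeasurableSet.iInter fun i => hI i (by omega) _
  · exact MeasurableSet.iInter fun i => hY i i.2 _

open Classical in
lemma edgeWeight_succ (ℓ₀ : E → ℕ) (Y : ℕ → Ω → E) (n : ℕ) (e : E) (ω : Ω) :
    edgeWeight ℓ₀ Y (n + 1) e ω = edgeWeight ℓ₀ Y n e ω + if Y n ω = e then 1 else 0 := by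
  unfold edgeWeight
  rw [Finset.range_add_one, Finset.filter_insert]
  split_ifs with h
  · rw [Finset.card_insert_of_notMem (by simp)]; ring
  · rfl

@[simp] lemma edgeWeight_zero (ℓ₀ : E → ℕ) (Y : ℕ → Ω → E) (e : E) (ω : Ω) :
    edgeWeight ℓ₀ Y 0 e ω = ℓ₀ e := by
  simp [edgeWeight]

lemma le_edgeWeight (ℓ₀ : E → ℕ) (Y : ℕ → Ω → E) (n : ℕ) (e : E) (ω : Ω) :
    ℓ₀ e ≤ edgeWeight ℓ₀ Y n e ω := Nat.le_add_right _ _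

lemma edgeWeight_congr (ℓ₀ : E → ℕ) (Y : ℕ → Ω → E) (n : ℕ) (e : E) {ω ω' : Ω}
    (h : ∀ i < n, Y i ω = Y i ω') : edgeWeight ℓ₀ Y n e ω = edgeWeight ℓ₀ Y n e ω' := by
  induction n with
  | zero => simp
  | succ n ih =>
    rw [edgeWeight_succ, edgeWeight_succ, ih fun i hi => h i (by omega), h n (by omega)]

lemma edgeWeight_mono (ℓ₀ : E → ℕ) (Y : ℕ → Ω → E) (e : E) (ω : Ω) :
    Monotone fun n => edgeWeight ℓ₀ Y n e ω :=
  monotone_nat_of_le_succ fun n => by rw [edgeWeight_succ]; exact Nat.le_add_right _ _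

/-- Turns the tail event into a change of edge at or after step `k`, with steps counted from `0`;
the clock offset `t₀` drops out. -/
lemma lt_attractionTime_iff (t₀ : ℕ) (Y : ℕ → Ω → E) (ω : Ω) (k : ℕ) :
    ((t₀ + k : ℕ) : ℕ∞) < attractionTime t₀ Y ω ↔ ∃ n, k ≤ n ∧ Y n ω ≠ Y (n + 1) ω := by
  unfold attractionTime
  constructor
  · intro h
    by_contra! hc
    exact absurd h (not_lt.mpr (iInf₂_le k hc))
  · rintro ⟨n, hn, hne⟩
    have : ((t₀ + k : ℕ) : ℕ∞) < ((t₀ + (k + 1) : ℕ) : ℕ∞) := by exact_mod_cast (by omega)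
    refine this.trans_le (le_iInf₂ fun j hj => ?_)
    have : n < j := by
      by_contra! hc
      exact hne (hj n hc)
    exact_mod_cast (by omega)

variable [MeasurableSpace Ω] {ends : E → Sym2 V} {w : ℕ → ℝ} {ℓ₀ : E → ℕ} {v₀ : V}
  {μ : Measure Ω} {I : ℕ → Ω → V} {Y : ℕ → Ω → E}

lemma IsERRW.past_le (h : IsERRW ends w ℓ₀ v₀ μ I Y) (n : ℕ) :
    past I Y n ≤ ‹MeasurableSpace Ω› := by
  refine sup_le (iSup₂_le fun i _ => ?_) (iSup₂_le fun i _ => ?_)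
  · exact (h.measurable_position i).comap_le
  · exact (h.measurable_edge i).comap_le

lemma IsERRW.measurableSet_of_forall [Countable V] [Countable E] (h : IsERRW ends w ℓ₀ v₀ μ I Y)
    (n : ℕ) (A : Set Ω)
    (hA : ∀ ω ω', (∀ i ≤ n, I i ω = I i ω') → (∀ i < n, Y i ω = Y i ω') → ω ∈ A → ω' ∈ A) :
    MeasurableSet A :=
  h.past_le n _ (measurableSet_past_of_forall I Y n A hA)

lemma IsERRW.measurableSet_edge (h : IsERRW ends w ℓ₀ v₀ μ I Y) (n : ℕ) (e : E) :
    MeasurableSet (Y n ⁻¹' {e}) :=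
  h.measurable_edge n (show MeasurableSet[⊤] {e} from trivial)

lemma IsERRW.integrable_stepProb (h : IsERRW ends w ℓ₀ v₀ μ I Y) (n : ℕ) (e : E) :
    Integrable (stepProb ends w ℓ₀ I Y n e) μ :=
  (integrable_condExp (m := past I Y n)).congr (h.rule n e)

/-- The probability of a step along `e` on an event of the past. -/
lemma IsERRW.measureReal_inter_edge (h : IsERRW ends w ℓ₀ v₀ μ I Y) (n : ℕ) (e : E) {A : Set Ω}
    (hA : MeasurableSet[past I Y n] A) :
    μ.real (A ∩ Y n ⁻¹' {e}) = ∫ ω in A, stepProb ends w ℓ₀ I Y n e ω ∂μ := by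
  have := h.isProbabilityMeasure
  have hA' : MeasurableSet A := h.past_le n _ hA
  have hm := h.measurableSet_edge n e
  rw [← setIntegral_congr_ae hA' ((h.rule n e).mono fun ω hω _ => hω),
    setIntegral_condExp (h.past_le n) ((integrable_const (1 : ℝ)).indicator hm) hA]
  rw [setIntegral_indicator hm]
  simp

lemma IsERRW.measureReal_inter_edge_eq (h : IsERRW ends w ℓ₀ v₀ μ I Y) (n : ℕ) (e : E) {A : Set Ω}
    (hA : MeasurableSet[past I Y n] A) (c : ℝ)
    (hc : ∀ᵐ ω ∂μ, ω ∈ A → stepProb ends w ℓ₀ I Y n e ω = c) :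
    μ.real (A ∩ Y n ⁻¹' {e}) = c * μ.real A := by
  have := h.isProbabilityMeasure
  have hA' : MeasurableSet A := h.past_le n _ hA
  rw [h.measureReal_inter_edge n e hA, setIntegral_congr_ae hA' hc, setIntegral_const,
    smul_eq_mul, mul_comm]

lemma IsERRW.le_measureReal_inter_edge (h : IsERRW ends w ℓ₀ v₀ μ I Y) (n : ℕ) (e : E) {A : Set Ω}
    (hA : MeasurableSet[past I Y n] A) (c : ℝ)
    (hc : ∀ᵐ ω ∂μ, ω ∈ A → c ≤ stepProb ends w ℓ₀ I Y n e ω) :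
    c * μ.real A ≤ μ.real (A ∩ Y n ⁻¹' {e}) := by
  have := h.isProbabilityMeasure
  have hA' : MeasurableSet A := h.past_le n _ hA
  rw [h.measureReal_inter_edge n e hA, mul_comm, ← smul_eq_mul, ← setIntegral_const]
  exact setIntegral_mono_on_ae (integrable_const c).integrableOn
    (h.integrable_stepProb n e).integrableOn hA' hc

end Basics

/-! ### Lower bound for the tail on two parallel edges. -/

section TwoEdges

/-- By `hr` each interior value is a weighted average of its two predecessors, so a lower bound on
the axes propagates. -/
lemma min_principle {a : ℕ → ℝ} (ha : ∀ i, 0 < a i) {r : ℕ → ℕ → ℝ} {c : ℝ}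
    (h0 : ∀ i, c ≤ r i 0) (h1 : ∀ j, c ≤ r 0 j)
    (hr : ∀ i j, r (i + 1) (j + 1) * (a (i + 1) + a (j + 1)) =
      r i (j + 1) * a (i + 1) + r (i + 1) j * a (j + 1)) (i j : ℕ) : c ≤ r i j := by
  induction i generalizing j with
  | zero => exact h1 j
  | succ i ihi =>
    induction j with
    | zero => exact h0 _
    | succ j ihj =>
      have h2 := hr i j
      have h3 := mul_le_mul_of_nonneg_right (ihi (j + 1)) (ha (i + 1)).le
      have h4 := mul_le_mul_of_nonneg_right ihj (ha (j + 1)).le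
      have h5 : 0 < a (i + 1) + a (j + 1) := add_pos (ha _) (ha _)
      refine le_of_mul_le_mul_right ?_ h5
      rw [h2]; linarith

/-- A quantity that decreases by the factors `a k / (a k + s)` stays bounded away from `0` when
`∑ 1 / a k` converges. -/
lemma exp_le_of_step {a : ℕ → ℝ} (ha : ∀ i, 0 < a i) (hs : Summable fun i => 1 / a i) {s : ℝ}
    (hs0 : 0 ≤ s) {x : ℕ → ℝ} (hx0 : 0 ≤ x 0)
    (hx : ∀ n, a n / (a n + s) * x n ≤ x (n + 1)) (n : ℕ) :
    Real.exp (-(s * ∑' i, 1 / a i)) * x 0 ≤ x n := by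
  have key : ∀ n, Real.exp (-(s * ∑ i ∈ Finset.range n, 1 / a i)) * x 0 ≤ x n := by
    intro n
    induction n with
    | zero => simp
    | succ n ih =>
      refine le_trans ?_ (hx n)
      -- The inequality `1 + s / a n ≤ exp (s / a n)`, inverted.
      have h1 : Real.exp (-(s * (1 / a n))) ≤ a n / (a n + s) := by
        rw [Real.exp_neg, ← inv_div (a n + s) (a n)]
        refine inv_anti₀ (div_pos (by have := ha n; linarith) (ha n)) ?_
        have h2 := Real.add_one_le_exp (s * (1 / a n))
        have h3 : (a n + s) / a n = s * (1 / a n) + 1 := by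
          have := ha n
          field_simp
          ring
        rw [h3]; exact h2
      rw [Finset.sum_range_succ, mul_add, neg_add, Real.exp_add]
      calc _ = Real.exp (-(s * (1 / a n))) *
            (Real.exp (-(s * ∑ i ∈ Finset.range n, 1 / a i)) * x 0) := by ring
        _ ≤ a n / (a n + s) * x n := by
          refine mul_le_mul h1 ih (by positivity) ?_
          have := ha n
          positivity
  refine le_trans ?_ (key n)
  gcongr
  exact hs.sum_le_tsum _ fun i _ => (div_pos one_pos (ha i)).le

variable {Ω : Type*} {w : ℕ → ℝ} {J : ℕ → Ω → Fin 2}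
  {Z : ℕ → Ω → Bool}

lemma twoEdges_weight_add (n : ℕ) (ω : Ω) :
    edgeWeight (fun _ => 1) Z n true ω + edgeWeight (fun _ => 1) Z n false ω = n + 2 := by
  induction n with
  | zero => simp
  | succ n ih =>
    rw [edgeWeight_succ, edgeWeight_succ]
    cases h : Z n ω <;> simp <;> omega

lemma twoEdges_stepProb (n : ℕ) (e : Bool) (ω : Ω) :
    stepProb twoEdges w (fun _ => 1) J Z n e ω =
      w (edgeWeight (fun _ => 1) Z n e ω) / (w (edgeWeight (fun _ => 1) Z n true ω) +
        w (edgeWeight (fun _ => 1) Z n false ω)) := by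
  have h : ∀ e, J n ω ∈ twoEdges e := by
    intro e
    unfold twoEdges
    generalize J n ω = x
    fin_cases x <;> simp
  unfold stepProb
  rw [if_pos (h e)]
  congr 1
  simp only [h, finsum_true]
  rw [finsum_eq_sum_of_fintype]
  simp

/-- The event that after `i + j` steps the edges `true` and `false` have been traversed `i` and `j`
times. -/
def urnState (Z : ℕ → Ω → Bool) (i j : ℕ) : Set Ω :=
  {ω | edgeWeight (fun _ => 1) Z (i + j) true ω = i + 1}

lemma urnState_false {i j : ℕ} {ω : Ω} (h : ω ∈ urnState Z i j) :
    edgeWeight (fun _ => 1) Z (i + j) false ω = j + 1 := by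
  have := twoEdges_weight_add (Z := Z) (i + j) ω
  have h' : edgeWeight (fun _ => 1) Z (i + j) true ω = i + 1 := h
  omega

lemma measurableSet_urnState (i j : ℕ) : MeasurableSet[past J Z (i + j)] (urnState Z i j) := by
  refine measurableSet_past_of_forall _ _ _ _ fun ω ω' _ h hω => ?_
  have hω : edgeWeight (fun _ => 1) Z (i + j) true ω = i + 1 := hω
  change edgeWeight (fun _ => 1) Z (i + j) true ω' = i + 1
  rw [← edgeWeight_congr _ _ _ _ h, hω]

lemma urnState_succ_succ (i j : ℕ) : urnState Z (i + 1) (j + 1) =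
    (urnState Z i (j + 1) ∩ Z (i + (j + 1)) ⁻¹' {true}) ∪
      (urnState Z (i + 1) j ∩ Z (i + 1 + j) ⁻¹' {false}) := by
  ext ω
  have e1 : i + 1 + (j + 1) = i + j + 1 + 1 := by ring
  have e2 : i + (j + 1) = i + j + 1 := by ring
  have e3 : i + 1 + j = i + j + 1 := by ring
  simp only [urnState, Set.mem_ofPred_eq, Set.mem_union, Set.mem_inter_iff, Set.mem_preimage,
    Set.mem_singleton_iff, e1, e2, e3]
  rw [edgeWeight_succ]
  cases h : Z (i + j + 1) ω <;> simp

lemma urnState_succ_zero (i : ℕ) : urnState Z (i + 1) 0 =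
    urnState Z i 0 ∩ Z i ⁻¹' {true} := by
  ext ω
  have h2 := twoEdges_weight_add (Z := Z) i ω
  have h3 := le_edgeWeight (fun _ => 1) Z i false ω
  simp only [urnState, Set.mem_ofPred_eq, Set.mem_inter_iff, Set.mem_preimage,
    Set.mem_singleton_iff, add_zero]
  rw [edgeWeight_succ]
  cases h : Z i ω <;> simp at h2 h3 ⊢
  omega

lemma urnState_zero_succ (j : ℕ) : urnState Z 0 (j + 1) =
    urnState Z 0 j ∩ Z j ⁻¹' {false} := by
  ext ω
  have h3 := le_edgeWeight (fun _ => 1) Z j true ω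
  simp only [urnState, Set.mem_ofPred_eq, Set.mem_inter_iff, Set.mem_preimage,
    Set.mem_singleton_iff, zero_add]
  rw [edgeWeight_succ]
  cases h : Z j ω <;> simp
  omega

lemma urnState_zero_zero : urnState Z 0 0 = (Set.univ : Set Ω) := by
  ext ω; simp [urnState]

variable [MeasurableSpace Ω] {ν : Measure Ω}

lemma urnState_step_true (hZ : IsERRW twoEdges w (fun _ => 1) 0 ν J Z) (i j : ℕ) :
    ν.real (urnState Z i j ∩ Z (i + j) ⁻¹' {true}) =
      w (i + 1) / (w (i + 1) + w (j + 1)) * ν.real (urnState Z i j) := by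
  refine hZ.measureReal_inter_edge_eq _ _ (measurableSet_urnState i j) _ (ae_of_all _ ?_)
  intro ω hω
  have h1 : edgeWeight (fun _ => 1) Z (i + j) true ω = i + 1 := hω
  rw [twoEdges_stepProb, urnState_false hω, h1]

lemma urnState_step_false (hZ : IsERRW twoEdges w (fun _ => 1) 0 ν J Z) (i j : ℕ) :
    ν.real (urnState Z i j ∩ Z (i + j) ⁻¹' {false}) =
      w (j + 1) / (w (i + 1) + w (j + 1)) * ν.real (urnState Z i j) := by
  refine hZ.measureReal_inter_edge_eq _ _ (measurableSet_urnState i j) _ (ae_of_all _ ?_)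
  intro ω hω
  have h1 : edgeWeight (fun _ => 1) Z (i + j) true ω = i + 1 := hω
  rw [twoEdges_stepProb, urnState_false hω, h1]

/-- All states of the two-edge process have, up to a constant, the probability
`1 / w a + 1 / w b`. -/
lemma exists_le_urnState (hZ : IsERRW twoEdges w (fun _ => 1) 0 ν J Z) (hw : ∀ k, 1 ≤ k → 0 < w k)
    (hs : Summable fun k => 1 / w (k + 1)) :
    ∃ c > 0, ∀ i j, c / w (j + 1) ≤ ν.real (urnState Z i j) := by
  have := hZ.isProbabilityMeasure
  set a : ℕ → ℝ := fun i => w (i + 1) with ha_def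
  have ha : ∀ i, 0 < a i := fun i => hw _ (by omega)
  set p : ℕ → ℕ → ℝ := fun i j => ν.real (urnState Z i j) with hp
  -- `r i j` is `a i` times the probability of stepping from `(i, j)` along `false`, and equally `a
  -- j` times that of stepping along `true`; this normalisation turns the recursion for `p` into an
  -- average.
  set r : ℕ → ℕ → ℝ := fun i j => p i j * (a i * a j) / (a i + a j) with hrdef
  have hp00 : p 0 0 = 1 := by simp [hp, urnState_zero_zero]
  have hpi : ∀ i, p (i + 1) 0 = a i / (a i + a 0) * p i 0 := by
    intro i
    have := urnState_step_true hZ i 0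
    simp only [add_zero] at this
    simp only [hp]
    rw [urnState_succ_zero, this]
  have hpj : ∀ j, p 0 (j + 1) = a j / (a 0 + a j) * p 0 j := by
    intro j
    have := urnState_step_false hZ 0 j
    simp only [zero_add] at this
    simp only [hp]
    rw [urnState_zero_succ, this]
  have hpij : ∀ i j, p (i + 1) (j + 1) = a i / (a i + a (j + 1)) * p i (j + 1) +
      a j / (a (i + 1) + a j) * p (i + 1) j := by
    intro i j
    simp only [hp]
    rw [urnState_succ_succ, measureReal_union, urnState_step_true hZ, urnState_step_false hZ]
    · have e2 : i + (j + 1) = i + 1 + j := by ring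
      rw [e2, Set.disjoint_left]
      rintro ω ⟨-, h1⟩ ⟨-, h2⟩
      simp only [Set.mem_preimage, Set.mem_singleton_iff] at h1 h2
      rw [h1] at h2; exact Bool.noConfusion h2
    · exact ((hZ.past_le _) _ (measurableSet_urnState (J := J) _ _)).inter (hZ.measurableSet_edge _ _)
  have hr : ∀ i j, r (i + 1) (j + 1) * (a (i + 1) + a (j + 1)) =
      r i (j + 1) * a (i + 1) + r (i + 1) j * a (j + 1) := by
    intro i j
    simp only [hrdef]
    rw [hpij]
    have h1 := ha i
    have h2 := ha j
    have h3 := ha (i + 1)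
    have h4 := ha (j + 1)
    have h5 : a i + a (j + 1) ≠ 0 := by positivity
    have h6 : a (i + 1) + a j ≠ 0 := by positivity
    have h7 : a (i + 1) + a (j + 1) ≠ 0 := by positivity
    field_simp
  set c := Real.exp (-(a 0 * ∑' i, 1 / a (i + 1))) * r 0 0 with hc
  have hr00 : 0 < r 0 0 := by
    simp only [hrdef, hp00]
    have := ha 0
    positivity
  -- On the axes `r` changes by the factor `a (n + 1) / (a (n + 1) + a 0)`, whence the shifted
  -- series.
  have hs' : Summable fun i => 1 / a (i + 1) :=
    (summable_nat_add_iff (f := fun i => 1 / a i) 1).mpr hs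
  have hr0 : ∀ i, c ≤ r i 0 := by
    refine exp_le_of_step (x := fun i => r i 0) (fun i => ha (i + 1)) hs' (ha 0).le hr00.le
      fun n => le_of_eq ?_
    simp only [hrdef]
    rw [hpi]
    have h1 := ha n
    have h2 := ha 0
    have h3 := ha (n + 1)
    field_simp
  have hr1 : ∀ j, c ≤ r 0 j := by
    refine exp_le_of_step (x := fun j => r 0 j) (fun i => ha (i + 1)) hs' (ha 0).le hr00.le
      fun n => le_of_eq ?_
    simp only [hrdef]
    rw [hpj]
    have h1 := ha n
    have h2 := ha 0
    have h3 := ha (n + 1)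
    rw [add_comm (a 0) (a (n + 1)), add_comm (a 0) (a n)]
    field_simp
  refine ⟨c, by positivity, fun i j => ?_⟩
  have h := min_principle ha hr0 hr1 hr i j
  have h1 := ha i
  have h2 := ha j
  change c / a j ≤ p i j
  have h3 : r i j / a j ≤ p i j := by
    simp only [hrdef]
    rw [div_div, div_le_iff₀ (by positivity)]
    have : 0 ≤ p i j := measureReal_nonneg
    nlinarith [mul_nonneg this (mul_pos h2 h2).le]
  refine le_trans ?_ h3
  gcongr

/-- From the state `(i, j)` the walk takes `t` steps along the edge `true`. -/
def urnRun (Z : ℕ → Ω → Bool) (i j t : ℕ) : Set Ω :=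
  urnState Z i j ∩ {ω | ∀ l < t, Z (i + j + l) ω = true}

omit [MeasurableSpace Ω] in
lemma urnRun_succ (i j t : ℕ) :
    urnRun Z i j (t + 1) = urnRun Z i j t ∩ Z (i + j + t) ⁻¹' {true} := by
  ext ω
  simp only [urnRun, Set.mem_inter_iff, Set.mem_ofPred_eq, Set.mem_preimage,
    Set.mem_singleton_iff, and_assoc, Nat.lt_succ_iff_lt_or_eq]
  refine and_congr_right fun _ => ⟨fun h => ⟨fun l hl => h l (Or.inl hl), h t (Or.inr rfl)⟩, ?_⟩
  rintro ⟨h1, h2⟩ l (hl | rfl)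
  exacts [h1 l hl, h2]

omit [MeasurableSpace Ω] in
lemma urnRun_subset (i j t : ℕ) : urnRun Z i j t ⊆ urnState Z (i + t) j := by
  induction t with
  | zero => exact Set.inter_subset_left
  | succ t ih =>
    rw [urnRun_succ]
    rintro ω ⟨h1, h2⟩
    have h3 : edgeWeight (fun _ => 1) Z (i + t + j) true ω = i + t + 1 := ih h1
    have h4 : Z (i + t + j) ω = true := by
      rw [show i + t + j = i + j + t by ring]; exact h2
    change edgeWeight (fun _ => 1) Z (i + (t + 1) + j) true ω = i + (t + 1) + 1
    rw [show i + (t + 1) + j = i + t + j + 1 by ring, edgeWeight_succ, h3, h4]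
    simp [add_assoc]

omit [MeasurableSpace Ω] in
lemma measurableSet_urnRun (i j t : ℕ) : MeasurableSet[past J Z (i + j + t)] (urnRun Z i j t) := by
  refine measurableSet_past_of_forall _ _ _ _ fun ω ω' _ h hω => ?_
  have hω1 : edgeWeight (fun _ => 1) Z (i + j) true ω = i + 1 := hω.1
  refine ⟨?_, fun l hl => ?_⟩
  · change edgeWeight (fun _ => 1) Z (i + j) true ω' = i + 1
    rw [← edgeWeight_congr _ _ _ _ fun l hl => h l (by omega), hω1]
  · rw [← h _ (by omega)]; exact hω.2 l hl

lemma urnRun_step (hZ : IsERRW twoEdges w (fun _ => 1) 0 ν J Z) (i j t : ℕ) :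
    ν.real (urnRun Z i j t ∩ Z (i + j + t) ⁻¹' {true}) =
      w (i + t + 1) / (w (i + t + 1) + w (j + 1)) * ν.real (urnRun Z i j t) ∧
    ν.real (urnRun Z i j t ∩ Z (i + j + t) ⁻¹' {false}) =
      w (j + 1) / (w (i + t + 1) + w (j + 1)) * ν.real (urnRun Z i j t) := by
  constructor
  all_goals
    refine hZ.measureReal_inter_edge_eq _ _ (measurableSet_urnRun i j t) _ (ae_of_all _ ?_)
    intro ω hω
    have h := urnRun_subset _ _ _ hω
    have h1 : edgeWeight (fun _ => 1) Z (i + t + j) true ω = i + t + 1 := h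
    rw [twoEdges_stepProb, show i + j + t = i + t + j by ring, urnState_false h, h1]

/-- During the run `true` only gains weight, so each step fails with probability at most `x = w (j +
1) / w (i + 1)`; Bernoulli's inequality gives `(1 - x) ^ t ≥ 1 - t * x ≥ 1 / 2`. -/
lemma le_urnRun (hZ : IsERRW twoEdges w (fun _ => 1) 0 ν J Z) (hw : ∀ k, 1 ≤ k → 0 < w k)
    {i j : ℕ} (hmono : ∀ l, i + 1 ≤ l → w (i + 1) ≤ w l) (t : ℕ)
    (ht : t * (w (j + 1) / w (i + 1)) ≤ 1 / 2) :
    1 / 2 * ν.real (urnState Z i j) ≤ ν.real (urnRun Z i j t) := by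
  have := hZ.isProbabilityMeasure
  have hi := hw (i + 1) (by omega)
  have hj := hw (j + 1) (by omega)
  set x := w (j + 1) / w (i + 1) with hx
  have hx0 : 0 < x := div_pos hj hi
  rcases Nat.eq_zero_or_pos t with rfl | htpos
  · have : urnRun Z i j 0 = urnState Z i j := by simp [urnRun]
    rw [this]
    have : 0 ≤ ν.real (urnState Z i j) := measureReal_nonneg
    linarith
  have hx1 : x ≤ 1 / 2 := by
    refine le_trans ?_ ht
    have : (1 : ℝ) ≤ t := by exact_mod_cast htpos
    nlinarith
  have key : ∀ t, (1 - x) ^ t * ν.real (urnState Z i j) ≤ ν.real (urnRun Z i j t) := by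
    intro t
    induction t with
    | zero => simp [urnRun]
    | succ t ih =>
      rw [urnRun_succ, (urnRun_step hZ i j t).1, pow_succ']
      have h1 : 1 - x ≤ w (i + t + 1) / (w (i + t + 1) + w (j + 1)) := by
        have h2 := hmono (i + t + 1) (by omega)
        rw [le_div_iff₀ (by linarith)]
        have h3 : w (j + 1) = x * w (i + 1) := by rw [hx]; field_simp
        rw [h3]
        have h4 : x * w (i + 1) ≤ x * w (i + t + 1) := by gcongr
        have h5 : 0 ≤ x * (x * w (i + 1)) := by positivity
        linarith
      rw [mul_assoc]
      exact mul_le_mul h1 ih (mul_nonneg (pow_nonneg (by linarith) _) measureReal_nonneg)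
        (le_trans (by linarith) h1)
  refine le_trans ?_ (key t)
  have h6 : 1 + (t : ℝ) * (-x) ≤ (1 + (-x)) ^ t := one_add_mul_le_pow (by linarith) t
  have h7 : 1 / 2 ≤ (1 - x) ^ t := by
    rw [sub_eq_add_neg]
    refine le_trans ?_ h6
    linarith
  exact mul_le_mul_of_nonneg_right h7 measureReal_nonneg

/-- Here `B` bounds the traversals of the light edge at time `k`, and `h` bounds the weight of the
heavy one from below. The factor `w (j + 1)` from the final step along the light edge cancels the `1
/ w (j + 1)` from the state, so all `B * k` scenarios have the same lower bound, of order `1 / w (2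
* k)`. -/
lemma exists_le_tail_twoEdges (hZ : IsERRW twoEdges w (fun _ => 1) 0 ν J Z)
    (hw : ∀ k, 1 ≤ k → 0 < w k) (hs : Summable fun k => 1 / w (k + 1))
    (hmono : ∀ a b, 2 ≤ a → a ≤ b → w a ≤ w b) :
    ∃ c > 0, ∀ k B h : ℕ, 2 ≤ h → h + B + 1 ≤ k → k * w (B + 1) ≤ 1 / 2 * w h →
      c * (B * k / w (2 * k)) ≤ tail ν 2 Z k := by
  have := hZ.isProbabilityMeasure
  obtain ⟨c, hc, hcS⟩ := exists_le_urnState hZ hw hs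
  refine ⟨c / 4, by positivity, fun k B h hh hhB hk => ?_⟩
  -- The clock starts at `2`, so time `k` comes after `n = k - 2` steps.
  obtain ⟨n, rfl⟩ : ∃ n, k = 2 + n := ⟨k - 2, by omega⟩
  let L : ℕ × ℕ → Set Ω := fun x =>
    urnRun Z (n - (x.1 + 1)) (x.1 + 1) (x.2 + 1) ∩ Z (n + (x.2 + 1)) ⁻¹' {false}
  let F : Finset (ℕ × ℕ) := Finset.range B ×ˢ Finset.range (2 + n)
  have hidx : ∀ x ∈ F, x.1 < B ∧ x.2 < 2 + n ∧ n - (x.1 + 1) + (x.1 + 1) = n := by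
    intro x hx
    simp only [F, Finset.mem_product, Finset.mem_range] at hx
    omega
  have hsub : ⋃ x ∈ F, L x ⊆ {ω | ((2 + n : ℕ) : ℕ∞) < attractionTime 2 Z ω} := by
    refine Set.iUnion₂_subset fun x hx ω hω => ?_
    obtain ⟨h1, h2, h3⟩ := hidx x hx
    refine (lt_attractionTime_iff 2 Z ω n).mpr ⟨n + x.2, by omega, ?_⟩
    have h4 := hω.1.2 x.2 (by omega)
    rw [h3] at h4
    have h5 : Z (n + (x.2 + 1)) ω = false := hω.2
    rw [h4, add_assoc, h5]
    simp
  have hmeas : ∀ x ∈ F, MeasurableSet (L x) := by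
    intro x hx
    exact ((hZ.past_le _) _ (measurableSet_urnRun (J := J) _ _ _)).inter (hZ.measurableSet_edge _ _)
  -- The state after `n` steps determines the first index, the first later step along `false` the
  -- second.
  have hdisj : Set.PairwiseDisjoint (F : Set (ℕ × ℕ)) L := by
    intro x hx y hy hxy
    rw [Function.onFun, Set.disjoint_left]
    intro ω hωx hωy
    apply hxy
    obtain ⟨-, -, h1⟩ := hidx x hx
    obtain ⟨-, -, h2⟩ := hidx y hy
    have hx1 := urnState_false hωx.1.1
    have hy1 := urnState_false hωy.1.1
    rw [h1] at hx1
    rw [h2] at hy1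
    have e1 : x.1 = y.1 := by omega
    have hx2 := hωx.1.2
    have hy2 := hωy.1.2
    have hx3 : Z (n + (x.2 + 1)) ω = false := hωx.2
    have hy3 : Z (n + (y.2 + 1)) ω = false := hωy.2
    have e2 : x.2 = y.2 := by
      rcases lt_trichotomy x.2 y.2 with hlt | heq | hlt
      · have := hy2 (x.2 + 1) (by omega)
        rw [h2, hx3] at this
        exact absurd this (by simp)
      · exact heq
      · have := hx2 (y.2 + 1) (by omega)
        rw [h1, hy3] at this
        exact absurd this (by simp)
    exact Prod.ext e1 e2
  have hbound : ∀ x ∈ F, c / 4 * (1 / w (2 * (2 + n))) ≤ ν.real (L x) := by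
    intro x hx
    obtain ⟨h1, h2, h3⟩ := hidx x hx
    set i := n - (x.1 + 1) with hi
    have hstep := (urnRun_step hZ i (x.1 + 1) (x.2 + 1)).2
    rw [h3] at hstep
    change _ ≤ ν.real (urnRun Z i (x.1 + 1) (x.2 + 1) ∩ Z (n + (x.2 + 1)) ⁻¹' {false})
    rw [hstep]
    have hwi := hw (i + 1) (by omega)
    have hwj := hw (x.1 + 1 + 1) (by omega)
    have hwh := hw h (by omega)
    have hih : w h ≤ w (i + 1) := hmono _ _ hh (by omega)
    have hjB : w (x.1 + 1 + 1) ≤ w (B + 1) := hmono _ _ (by omega) (by omega)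
    have hrun := le_urnRun hZ hw (i := i) (j := x.1 + 1)
      (fun l hl => hmono _ _ (by omega) hl) (x.2 + 1) (by
        rw [← mul_div_assoc, div_le_iff₀ hwi]
        have hx2 : ((x.2 + 1 : ℕ) : ℝ) ≤ (2 + n : ℕ) := by exact_mod_cast h2
        calc ((x.2 + 1 : ℕ) : ℝ) * w (x.1 + 1 + 1) ≤ (2 + n : ℕ) * w (B + 1) := by gcongr
          _ ≤ 1 / 2 * w h := hk
          _ ≤ 1 / 2 * w (i + 1) := by gcongr)
    have hst := hcS i (x.1 + 1)
    have hw1 := hw (i + (x.2 + 1) + 1) (by omega)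
    have hw2 : w (i + (x.2 + 1) + 1) ≤ w (2 * (2 + n)) := hmono _ _ (by omega) (by omega)
    have hw3 : w (x.1 + 1 + 1) ≤ w (i + (x.2 + 1) + 1) := by
      refine hjB.trans ?_
      have hk' : w (B + 1) ≤ w h := by
        have hB := hw (B + 1) (by omega)
        have : (1 : ℝ) ≤ (2 + n : ℕ) := by exact_mod_cast (by omega)
        nlinarith
      exact hk'.trans (hmono _ _ hh (by omega))
    calc c / 4 * (1 / w (2 * (2 + n)))
        ≤ c / 4 * (1 / w (i + (x.2 + 1) + 1)) := by gcongr
      _ = w (x.1 + 1 + 1) / (2 * w (i + (x.2 + 1) + 1)) * (1 / 2 * (c / w (x.1 + 1 + 1))) := by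
        field_simp
        norm_num
      _ ≤ w (x.1 + 1 + 1) / (w (i + (x.2 + 1) + 1) + w (x.1 + 1 + 1)) *
          ν.real (urnRun Z i (x.1 + 1) (x.2 + 1)) := by
        refine mul_le_mul ?_ (le_trans (by gcongr) hrun) (by positivity) (by positivity)
        exact div_le_div_of_nonneg_left hwj.le (by positivity) (by linarith)
  calc c / 4 * (B * (2 + n : ℕ) / w (2 * (2 + n)))
      = ∑ x ∈ F, c / 4 * (1 / w (2 * (2 + n))) := by
        rw [Finset.sum_const, Finset.card_product]
        simp only [Finset.card_range, nsmul_eq_mul]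
        push_cast
        ring
    _ ≤ ∑ x ∈ F, ν.real (L x) := Finset.sum_le_sum hbound
    _ = ν.real (⋃ x ∈ F, L x) := (measureReal_biUnion_finset hdisj hmeas).symm
    _ ≤ tail ν 2 Z (2 + n) := measureReal_mono hsub

end TwoEdges

/-! ### Walks on a tree: crossings of a bridge. -/

section Trajectories

variable {V Ω : Type*} {G : SimpleGraph V} {v₀ : V}

/-- The sample points on which the walk is a genuine trajectory started at `v₀`. -/
def IsTrajectory (v₀ : V) (I : ℕ → Ω → V) (Y : ℕ → Ω → G.edgeSet) (ω : Ω) : Prop :=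
  I 0 ω = v₀ ∧ ∀ n, (Y n ω : Sym2 V) = s(I n ω, I (n + 1) ω)

lemma IsERRW.ae_isTrajectory [MeasurableSpace Ω] {w : ℕ → ℝ} {ℓ₀ : G.edgeSet → ℕ} {μ : Measure Ω}
    {I : ℕ → Ω → V} {Y : ℕ → Ω → G.edgeSet} (h : IsERRW (simpleEnds G) w ℓ₀ v₀ μ I Y) :
    ∀ᵐ ω ∂μ, IsTrajectory v₀ I Y ω :=
  h.start.and (ae_all_iff.mpr h.step)

open Classical in
/-- The number of steps from `v` along `e` among the first `n` steps. -/
noncomputable def outCount (I : ℕ → Ω → V) (Y : ℕ → Ω → G.edgeSet) (v : V) (e : G.edgeSet) (n : ℕ)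
    (ω : Ω) : ℕ :=
  Nat.count (fun m => I m ω = v ∧ Y m ω = e) n

variable {I : ℕ → Ω → V} {Y : ℕ → Ω → G.edgeSet}

open Classical in
lemma outCount_succ (v : V) (e : G.edgeSet) (n : ℕ) (ω : Ω) :
    outCount I Y v e (n + 1) ω =
      outCount I Y v e n ω + if I n ω = v ∧ Y n ω = e then 1 else 0 := by
  unfold outCount
  rw [Nat.count_succ]

@[simp] lemma outCount_zero (v : V) (e : G.edgeSet) (ω : Ω) : outCount I Y v e 0 ω = 0 := by
  simp [outCount]

lemma outCount_congr (v : V) (e : G.edgeSet) (n : ℕ) {ω ω' : Ω} (hI : ∀ i < n, I i ω = I i ω')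
    (hY : ∀ i < n, Y i ω = Y i ω') : outCount I Y v e n ω = outCount I Y v e n ω' := by
  induction n with
  | zero => simp
  | succ n ih =>
    rw [outCount_succ, outCount_succ, ih (fun i hi => hI i (by omega)) fun i hi => hY i (by omega),
      hI n (by omega), hY n (by omega)]

lemma outCount_mono (v : V) (e : G.edgeSet) (ω : Ω) : Monotone fun n => outCount I Y v e n ω :=
  monotone_nat_of_le_succ fun n => by rw [outCount_succ]; exact Nat.le_add_right _ _

lemma IsTrajectory.mem_edge {ω : Ω} (h : IsTrajectory v₀ I Y ω) (n : ℕ) :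
    I n ω ∈ (Y n ω : Sym2 V) := by rw [h.2 n]; exact Sym2.mem_mk_left _ _

lemma IsTrajectory.mem_edge' {ω : Ω} (h : IsTrajectory v₀ I Y ω) (n : ℕ) :
    I (n + 1) ω ∈ (Y n ω : Sym2 V) := by rw [h.2 n]; exact Sym2.mem_mk_right _ _

lemma IsTrajectory.adj {ω : Ω} (h : IsTrajectory v₀ I Y ω) (n : ℕ) :
    G.Adj (I n ω) (I (n + 1) ω) := by
  have := (Y n ω).2
  rwa [h.2 n] at this

lemma IsTrajectory.adj_deleteEdges {ω : Ω} (h : IsTrajectory v₀ I Y ω) {n : ℕ} {e : G.edgeSet}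
    (hne : Y n ω ≠ e) : (G.deleteEdges {(e : Sym2 V)}).Adj (I n ω) (I (n + 1) ω) := by
  rw [SimpleGraph.deleteEdges_adj]
  refine ⟨h.adj n, fun hmem => hne (Subtype.ext ?_)⟩
  rw [h.2 n]; exact hmem

lemma IsTrajectory.reachable_deleteEdges {ω : Ω} (h : IsTrajectory v₀ I Y ω) {e : G.edgeSet}
    {m n : ℕ} (hmn : m ≤ n) (hne : ∀ l, m ≤ l → l < n → Y l ω ≠ e) :
    (G.deleteEdges {(e : Sym2 V)}).Reachable (I m ω) (I n ω) := by
  induction n, hmn using Nat.le_induction with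
  | base => exact SimpleGraph.Reachable.refl _
  | succ n hmn ih =>
    exact (ih fun l h1 h2 => hne l h1 (by omega)).trans
      (h.adj_deleteEdges (hne n hmn (by omega))).reachable

/-- In an acyclic graph the walk leaves `v` and returns to `v` through the same edge; hence at the
visits of `v` the weight of an incident edge is determined by the number of departures along it. -/
lemma exists_edgeWeight_eq (hG : G.IsAcyclic) (v₀ v : V) (e : G.edgeSet) (hv : v ∈ (e : Sym2 V)) :
    ∃ x, (x = 1 ∨ x = 2) ∧ ∀ {I : ℕ → Ω → V} {Y : ℕ → Ω → G.edgeSet} {ω : Ω},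
      IsTrajectory v₀ I Y ω → ∀ n, I n ω = v →
        edgeWeight (fun _ => 1) Y n e ω = x + 2 * outCount I Y v e n ω := by
  classical
  obtain ⟨u, hu⟩ := Sym2.mem_iff_exists.mp hv
  set H := G.deleteEdges {(e : Sym2 V)} with hH
  have hbr : ¬ H.Reachable v u := by
    have hadj : G.Adj v u := by have := e.2; rwa [hu] at this
    have := SimpleGraph.isAcyclic_iff_forall_adj_isBridge.mp hG hadj
    rw [SimpleGraph.isBridge_iff] at this
    rwa [hH, hu]
  have hvu : v ≠ u := fun h => hbr (h ▸ SimpleGraph.Reachable.refl _)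
  -- If the walk starts on the far side of `e`, it must cross `e` once before it can visit `v`.
  refine ⟨if H.Reachable v v₀ then 1 else 2, by split_ifs <;> simp, ?_⟩
  intro I Y ω hω
  set x := if H.Reachable v v₀ then 1 else 2 with hx
  -- While the walk is beyond `e`, one crossing towards `v` is outstanding; counting it in advance
  -- yields an invariant valid at all times.
  have key : ∀ n, edgeWeight (fun _ => 1) Y n e ω + (if H.Reachable v (I n ω) then 0 else 1) =
      x + 2 * outCount I Y v e n ω := by
    intro n
    induction n with
    | zero =>
      rw [edgeWeight_zero, outCount_zero, hω.1, hx]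
      split_ifs <;> rfl
    | succ n ih =>
      rw [edgeWeight_succ, outCount_succ]
      by_cases hYe : Y n ω = e
      · have hends := hω.2 n
        rw [hYe, hu, Sym2.eq_iff] at hends
        rcases hends with ⟨h1, h2⟩ | ⟨h1, h2⟩
        · rw [← h1, if_pos (SimpleGraph.Reachable.refl _)] at ih
          rw [← h2, if_neg hbr, if_pos hYe, if_pos ⟨h1.symm, hYe⟩]
          omega
        · rw [← h2, if_neg hbr] at ih
          rw [← h1, if_pos (SimpleGraph.Reachable.refl _), if_pos hYe,
            if_neg (by rintro ⟨h3, -⟩; exact hvu (h3.symm.trans h2.symm))]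
          omega
      · have hadj := (hω.adj_deleteEdges hYe).reachable
        have hiff : H.Reachable v (I (n + 1) ω) ↔ H.Reachable v (I n ω) :=
          ⟨fun h => h.trans hadj.symm, fun h => h.trans hadj⟩
        simp only [hiff, hYe, and_false, if_false, add_zero]
        exact ih
  intro n hn
  have := key n
  rwa [hn, if_pos (SimpleGraph.Reachable.refl _), add_zero] at this

end Trajectories

/-! ### Lattice paths of two counters, and the maximum principle. -/

section Counting

/-- A pair of counters that has left `(0, 0)` was increased in one of its coordinates. -/
lemma exists_pred_count {p q : ℕ → Prop} [DecidablePred p] [DecidablePred q]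
    (hpq : ∀ n, p n → ¬ q n) (n : ℕ) :
    (Nat.count p n = 0 ∧ Nat.count q n = 0) ∨
      (∃ m, p m ∧ Nat.count p m + 1 = Nat.count p n ∧ Nat.count q m = Nat.count q n) ∨
      (∃ m, q m ∧ Nat.count p m = Nat.count p n ∧ Nat.count q m + 1 = Nat.count q n) := by
  induction n with
  | zero => simp
  | succ n ih =>
    by_cases hp : p n
    · exact Or.inr (Or.inl ⟨n, hp, by simp [Nat.count_succ, hp], by simp [Nat.count_succ, hpq n hp]⟩)
    · by_cases hq : q n
      · exact Or.inr (Or.inr ⟨n, hq, by simp [Nat.count_succ, hp], by simp [Nat.count_succ, hq]⟩)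
      · simpa [Nat.count_succ, hp, hq] using ih

/-- A pair of counters that enters the quadrant `[a + 1, ∞) × [b, ∞)` does so through one of its
two sides. -/
lemma exists_enter_quadrant {p q : ℕ → Prop} [DecidablePred p] [DecidablePred q]
    (hpq : ∀ n, p n → ¬ q n) {a b n : ℕ} (ha : a + 1 ≤ Nat.count p n) (hb : b ≤ Nat.count q n) :
    (∃ m, p m ∧ Nat.count p m = a ∧ b ≤ Nat.count q m) ∨
      (∃ m, q m ∧ a + 1 ≤ Nat.count p m ∧ Nat.count q m + 1 = b) := by
  induction n with
  | zero => simp at ha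
  | succ n ih =>
    by_cases hp : p n
    · have hq := hpq n hp
      simp only [Nat.count_succ, hp, hq, if_true, if_false, add_zero] at ha hb
      rcases Nat.lt_or_ge a (Nat.count p n) with h | h
      · exact ih h hb
      · exact Or.inl ⟨n, hp, by omega, hb⟩
    · by_cases hq : q n
      · simp only [Nat.count_succ, hp, hq, if_true, if_false, add_zero] at ha hb
        rcases Nat.lt_or_ge (Nat.count q n) b with h | h
        · exact Or.inr ⟨n, hq, ha, by omega⟩
        · exact ih ha h
      · simp only [Nat.count_succ, hp, hq, if_false, add_zero] at ha hb
        exact ih ha hb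

/-- The common value `z i j = β j * x i j = α i * y i j` decreases along the axes, and `z (i + 1) (j
+ 1)` is at most an average of `z i (j + 1)` and `z (i + 1) j` with weights `α (i + 1)` and `β (j +
1)`. Only inequalities are available for the flow, since the walk may never return to `v`. -/
lemma max_principle {α β : ℕ → ℝ} (hα : ∀ i, 0 < α i) (hβ : ∀ j, 0 < β j) {x y : ℕ → ℕ → ℝ}
    (hy : ∀ i j, 0 ≤ y i j) (hx : ∀ i j, 0 ≤ x i j)
    (hxy : ∀ i j, β j * x i j = α i * y i j) {p : ℝ}
    (h00 : x 0 0 + y 0 0 ≤ p) (hi0 : ∀ i, x (i + 1) 0 + y (i + 1) 0 ≤ x i 0)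
    (h0j : ∀ j, x 0 (j + 1) + y 0 (j + 1) ≤ y 0 j)
    (hij : ∀ i j, x (i + 1) (j + 1) + y (i + 1) (j + 1) ≤ x i (j + 1) + y (i + 1) j) (i j : ℕ) :
    β j * x i j ≤ α 0 * p := by
  have base : β 0 * x 0 0 ≤ α 0 * p := by
    rw [hxy]
    exact mul_le_mul_of_nonneg_left (by linarith [hx 0 0]) (hα 0).le
  induction i generalizing j with
  | zero =>
    induction j with
    | zero => exact base
    | succ j ih =>
      rw [hxy] at ih ⊢
      exact le_trans (mul_le_mul_of_nonneg_left (by linarith [h0j j, hx 0 (j + 1)]) (hα 0).le) ih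
  | succ i ihi =>
    induction j with
    | zero =>
      exact le_trans (mul_le_mul_of_nonneg_left (by linarith [hi0 i, hy (i + 1) 0]) (hβ 0).le)
        (ihi 0)
    | succ j ihj =>
      have h1 := ihi (j + 1)
      rw [hxy] at ihj
      have h2 := hxy (i + 1) (j + 1)
      have h3 := hij i j
      have hA := hα (i + 1)
      have hB := hβ (j + 1)
      have h4 : (α (i + 1) + β (j + 1)) * (β (j + 1) * x (i + 1) (j + 1)) =
          α (i + 1) * β (j + 1) * (x (i + 1) (j + 1) + y (i + 1) (j + 1)) := by
        linear_combination β (j + 1) * h2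
      refine le_of_mul_le_mul_left ?_ (add_pos hA hB)
      rw [h4]
      calc _ ≤ α (i + 1) * β (j + 1) * (x i (j + 1) + y (i + 1) j) := by gcongr
        _ = α (i + 1) * (β (j + 1) * x i (j + 1)) + β (j + 1) * (α (i + 1) * y (i + 1) j) := by
          ring
        _ ≤ α (i + 1) * (α 0 * p) + β (j + 1) * (α 0 * p) := by gcongr
        _ = _ := by ring

end Counting

/-! ### Competition of two edges at a vertex of the tree. -/

section Competition

variable {V Ω : Type*} {G : SimpleGraph V} {v₀ : V} {I : ℕ → Ω → V} {Y : ℕ → Ω → G.edgeSet}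

/-- The walk is at `v` at time `n`, having left `v` so far `i` times along `e` and `j` times
along `f`. -/
def departState (I : ℕ → Ω → V) (Y : ℕ → Ω → G.edgeSet) (v : V) (e f : G.edgeSet) (i j n : ℕ) :
    Set Ω :=
  {ω | I n ω = v ∧ outCount I Y v e n ω = i ∧ outCount I Y v f n ω = j}

/-- The walk leaves `v` at some time along `g`, having left it before `i` times along `e` and `j`
times along `f`. -/
def depart (I : ℕ → Ω → V) (Y : ℕ → Ω → G.edgeSet) (v : V) (e f g : G.edgeSet) (i j : ℕ) : Set Ω :=
  ⋃ n, departState I Y v e f i j n ∩ Y n ⁻¹' {g}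

/-- The walk visits `v`. -/
def visits (I : ℕ → Ω → V) (v : V) : Set Ω := {ω | ∃ n, I n ω = v}

lemma mem_depart {v : V} {e f g : G.edgeSet} {i j : ℕ} {ω : Ω} :
    ω ∈ depart I Y v e f g i j ↔ ∃ n, I n ω = v ∧ Y n ω = g ∧ outCount I Y v e n ω = i ∧
      outCount I Y v f n ω = j := by
  simp only [depart, departState, Set.mem_iUnion, Set.mem_inter_iff, Set.mem_ofPred_eq,
    Set.mem_preimage, Set.mem_singleton_iff]
  exact exists_congr fun n => by tauto

lemma measurableSet_departState [Countable V] (v : V) (e f : G.edgeSet) (i j n : ℕ) :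
    MeasurableSet[past I Y n] (departState I Y v e f i j n) := by
  refine measurableSet_past_of_forall _ _ _ _ fun ω ω' hI hY hω => ?_
  obtain ⟨h1, h2, h3⟩ := hω
  refine ⟨(hI n le_rfl).symm.trans h1, ?_, ?_⟩
  · rw [← outCount_congr v e n (fun i hi => hI i hi.le) hY, h2]
  · rw [← outCount_congr v f n (fun i hi => hI i hi.le) hY, h3]

lemma outCount_lt_of_depart {v : V} {g : G.edgeSet} {n m : ℕ} {ω : Ω} (hI : I n ω = v)
    (hY : Y n ω = g) (hnm : n < m) : outCount I Y v g n ω < outCount I Y v g m ω := by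
  have h1 := outCount_succ (I := I) (Y := Y) v g n ω
  rw [if_pos ⟨hI, hY⟩] at h1
  have h2 := outCount_mono (I := I) (Y := Y) v g ω (show n + 1 ≤ m from hnm)
  simp only at h2
  omega

/-- Departures along third edges leave the state `(i, j)` unchanged, so it may persist over many
visits; a departure along `e` or `f` raises a counter and ends it for good. -/
lemma depart_time_unique {v : V} {e f g : G.edgeSet} (hg : g = e ∨ g = f) {i j n : ℕ} {ω : Ω}
    (h : ω ∈ departState I Y v e f i j n) (hY : Y n ω = g) {m : ℕ}
    (h' : ω ∈ departState I Y v e f i j m) : m ≤ n := by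
  by_contra! hlt
  have := outCount_lt_of_depart h.1 hY hlt
  rcases hg with rfl | rfl
  · rw [h.2.1, h'.2.1] at this; omega
  · rw [h.2.2, h'.2.2] at this; omega

lemma pairwise_disjoint_depart {v : V} {e f g : G.edgeSet} (hg : g = e ∨ g = f) (i j : ℕ) :
    Pairwise (Function.onFun Disjoint fun n => departState I Y v e f i j n ∩ Y n ⁻¹' {g}) := by
  intro m n hmn
  rw [Function.onFun, Set.disjoint_left]
  rintro ω ⟨h1, h2⟩ ⟨h3, h4⟩
  exact hmn (le_antisymm (depart_time_unique hg h3 h4 h1) (depart_time_unique hg h1 h2 h3))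

lemma disjoint_depart {v : V} {e f : G.edgeSet} (hef : e ≠ f) (i j : ℕ) :
    Disjoint (depart I Y v e f e i j) (depart I Y v e f f i j) := by
  rw [Set.disjoint_left]
  intro ω h1 h2
  simp only [depart, Set.mem_iUnion] at h1 h2
  obtain ⟨n, h1, h1'⟩ := h1
  obtain ⟨m, h2, h2'⟩ := h2
  have h3 := le_antisymm (depart_time_unique (Or.inr rfl) h2 h2' h1)
    (depart_time_unique (Or.inl rfl) h1 h1' h2)
  subst h3
  exact hef (h1'.symm.trans h2')

lemma exists_depart_pred {v : V} {e f g : G.edgeSet} (hef : e ≠ f) {i j : ℕ} {ω : Ω}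
    (h : ω ∈ depart I Y v e f g i j) :
    (i = 0 ∧ j = 0) ∨ (∃ i', i = i' + 1 ∧ ω ∈ depart I Y v e f e i' j) ∨
      ∃ j', j = j' + 1 ∧ ω ∈ depart I Y v e f f i j' := by
  classical
  obtain ⟨n, -, -, h1, h2⟩ := mem_depart.mp h
  have := exists_pred_count (p := fun m => I m ω = v ∧ Y m ω = e)
    (q := fun m => I m ω = v ∧ Y m ω = f) (fun m h h' => hef (h.2.symm.trans h'.2)) n
  unfold outCount at h1 h2
  rcases this with ⟨h3, h4⟩ | ⟨m, hm, h3, h4⟩ | ⟨m, hm, h3, h4⟩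
  · left
    constructor
    · rw [← h1]; convert h3
    · rw [← h2]; convert h4
  · right; left
    refine ⟨outCount I Y v e m ω, ?_, mem_depart.mpr ⟨m, hm.1, hm.2, rfl, ?_⟩⟩
    · rw [← h1]; unfold outCount; convert h3.symm
    · rw [← h2]; unfold outCount; convert h4
  · right; right
    refine ⟨outCount I Y v f m ω, ?_, mem_depart.mpr ⟨m, hm.1, hm.2, ?_, rfl⟩⟩
    · rw [← h2]; unfold outCount; convert h4.symm
    · rw [← h1]; unfold outCount; convert h3

lemma exists_depart_enter {v : V} {e f : G.edgeSet} (hef : e ≠ f) {a b n : ℕ} {ω : Ω}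
    (ha : a + 1 ≤ outCount I Y v e n ω) (hb : b ≤ outCount I Y v f n ω) :
    (∃ j, b ≤ j ∧ ω ∈ depart I Y v e f e a j) ∨
      ∃ i j, a + 1 ≤ i ∧ j < b ∧ ω ∈ depart I Y v e f f i j := by
  classical
  unfold outCount at ha hb
  have := exists_enter_quadrant (p := fun m => I m ω = v ∧ Y m ω = e)
    (q := fun m => I m ω = v ∧ Y m ω = f) (fun m h h' => hef (h.2.symm.trans h'.2))
    (a := a) (b := b) (n := n) (by convert ha) (by convert hb)
  rcases this with ⟨m, hm, h3, h4⟩ | ⟨m, hm, h3, h4⟩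
  · refine Or.inl ⟨outCount I Y v f m ω, ?_, mem_depart.mpr ⟨m, hm.1, hm.2, ?_, rfl⟩⟩
    · unfold outCount; convert h4
    · rw [← h3]; unfold outCount; congr!
  · refine Or.inr ⟨outCount I Y v e m ω, outCount I Y v f m ω, ?_, ?_,
      mem_depart.mpr ⟨m, hm.1, hm.2, rfl, rfl⟩⟩
    · unfold outCount; convert h3
    · rw [← h4]; unfold outCount
      refine lt_of_le_of_lt (le_of_eq ?_) (Nat.lt_succ_self _)
      congr!

variable [MeasurableSpace Ω] {w : ℕ → ℝ} {μ : Measure Ω}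

lemma IsERRW.measurableSet_depart [Countable V] (h : IsERRW (simpleEnds G) w (fun _ => 1) v₀ μ I Y)
    (v : V) (e f g : G.edgeSet) (i j : ℕ) : MeasurableSet (depart I Y v e f g i j) :=
  MeasurableSet.iUnion fun n =>
    (h.past_le n _ (measurableSet_departState v e f i j n)).inter (h.measurableSet_edge n g)

/-- From a given state, the departures along `e` and along `f` have probabilities proportional to
the weights. -/
lemma IsERRW.measureReal_depart [Countable V] (h : IsERRW (simpleEnds G) w (fun _ => 1) v₀ μ I Y)
    {v : V} {e f : G.edgeSet} (hve : v ∈ (e : Sym2 V)) (hvf : v ∈ (f : Sym2 V)) {a b : ℕ}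
    (ha : ∀ ω, IsTrajectory v₀ I Y ω → ∀ n, I n ω = v →
      edgeWeight (fun _ => 1) Y n e ω = a + 2 * outCount I Y v e n ω)
    (hb : ∀ ω, IsTrajectory v₀ I Y ω → ∀ n, I n ω = v →
      edgeWeight (fun _ => 1) Y n f ω = b + 2 * outCount I Y v f n ω) (i j : ℕ) :
    w (b + 2 * j) * μ.real (depart I Y v e f e i j) =
      w (a + 2 * i) * μ.real (depart I Y v e f f i j) := by
  have := h.isProbabilityMeasure
  have step : ∀ n, w (b + 2 * j) * μ.real (departState I Y v e f i j n ∩ Y n ⁻¹' {e}) =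
      w (a + 2 * i) * μ.real (departState I Y v e f i j n ∩ Y n ⁻¹' {f}) := by
    intro n
    have hm := measurableSet_departState (I := I) (Y := Y) v e f i j n
    rw [h.measureReal_inter_edge n e hm, h.measureReal_inter_edge n f hm, ← integral_const_mul,
      ← integral_const_mul]
    refine setIntegral_congr_ae (h.past_le n _ hm) ?_
    filter_upwards [h.ae_isTrajectory] with ω hω hS
    obtain ⟨h1, h2, h3⟩ := hS
    unfold stepProb
    rw [if_pos (by rw [h1]; exact hve), if_pos (by rw [h1]; exact hvf), ha ω hω n h1,
      hb ω hω n h1, h2, h3]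
    ring
  have hms : ∀ g n, MeasurableSet (departState I Y v e f i j n ∩ Y n ⁻¹' {g}) := fun g n =>
    (h.past_le n _ (measurableSet_departState v e f i j n)).inter (h.measurableSet_edge n g)
  have hsum : ∀ g, g = e ∨ g = f → HasSum
      (fun n => μ.real (departState I Y v e f i j n ∩ Y n ⁻¹' {g}))
      (μ.real (depart I Y v e f g i j)) := by
    intro g hg
    have hU := measure_iUnion (μ := μ) (pairwise_disjoint_depart (I := I) (v := v) hg i j) (hms g)
    unfold depart
    rw [measureReal_def, hU, ENNReal.tsum_toReal_eq fun n => measure_ne_top _ _]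
    exact (ENNReal.summable_toReal (by rw [← hU]; exact measure_ne_top _ _)).hasSum
  have h1 := (hsum e (Or.inl rfl)).mul_left (w (b + 2 * j))
  have h2 := (hsum f (Or.inr rfl)).mul_left (w (a + 2 * i))
  simp only [step] at h1
  exact h1.unique h2

/-- A state other than `(0, 0)` is reached only by a departure from one of its predecessors, so
`max_principle` applies, with the flow out of `(0, 0)` bounded by the probability of visiting `v`.
The initial weight `w a` is at most `w 1 + w 2`. -/
lemma IsERRW.measureReal_depart_le [Countable V]
    (h : IsERRW (simpleEnds G) w (fun _ => 1) v₀ μ I Y) (hw : ∀ k, 1 ≤ k → 0 < w k)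
    {v : V} {e f : G.edgeSet} (hef : e ≠ f) (hve : v ∈ (e : Sym2 V)) (hvf : v ∈ (f : Sym2 V))
    {a b : ℕ} (ha1 : a = 1 ∨ a = 2) (hb1 : b = 1 ∨ b = 2)
    (ha : ∀ ω, IsTrajectory v₀ I Y ω → ∀ n, I n ω = v →
      edgeWeight (fun _ => 1) Y n e ω = a + 2 * outCount I Y v e n ω)
    (hb : ∀ ω, IsTrajectory v₀ I Y ω → ∀ n, I n ω = v →
      edgeWeight (fun _ => 1) Y n f ω = b + 2 * outCount I Y v f n ω) (i j : ℕ) :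
    w (b + 2 * j) * μ.real (depart I Y v e f e i j) ≤ (w 1 + w 2) * μ.real (visits I v) := by
  have := h.isProbabilityMeasure
  have hun : ∀ i j, μ.real (depart I Y v e f e i j) + μ.real (depart I Y v e f f i j) =
      μ.real (depart I Y v e f e i j ∪ depart I Y v e f f i j) := fun i j =>
    (measureReal_union (disjoint_depart hef i j) (h.measurableSet_depart v e f f i j)).symm
  have hpred : ∀ {i j : ℕ} {ω : Ω}, ω ∈ depart I Y v e f e i j ∪ depart I Y v e f f i j →
      (i = 0 ∧ j = 0) ∨ (∃ i', i = i' + 1 ∧ ω ∈ depart I Y v e f e i' j) ∨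
      ∃ j', j = j' + 1 ∧ ω ∈ depart I Y v e f f i j' := by
    rintro i j ω (hω | hω)
    exacts [exists_depart_pred hef hω, exists_depart_pred hef hω]
  have hmax := max_principle (α := fun i => w (a + 2 * i)) (β := fun j => w (b + 2 * j))
    (x := fun i j => μ.real (depart I Y v e f e i j))
    (y := fun i j => μ.real (depart I Y v e f f i j)) (p := μ.real (visits I v))
    (fun i => hw _ (by omega)) (fun i => hw _ (by omega)) (fun _ _ => measureReal_nonneg)
    (fun _ _ => measureReal_nonneg) (h.measureReal_depart hve hvf ha hb) ?_ ?_ ?_ ?_ i j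
  · refine hmax.trans (mul_le_mul_of_nonneg_right ?_ measureReal_nonneg)
    have h1 := hw 1 le_rfl
    have h2 := hw 2 (by omega)
    rcases ha1 with rfl | rfl <;> simp <;> linarith
  · rw [hun]
    refine measureReal_mono ?_
    rintro ω (hω | hω) <;>
    · obtain ⟨n, hn, -⟩ := mem_depart.mp hω
      exact ⟨n, hn⟩
  · intro i
    rw [hun]
    refine measureReal_mono fun ω hω => ?_
    rcases hpred hω with ⟨h1, -⟩ | ⟨i', h1, h2⟩ | ⟨j', h1, -⟩
    · omega
    · obtain rfl : i = i' := by omega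
      exact h2
    · omega
  · intro j
    rw [hun]
    refine measureReal_mono fun ω hω => ?_
    rcases hpred hω with ⟨-, h1⟩ | ⟨i', h1, h2⟩ | ⟨j', h1, h2⟩
    · omega
    · omega
    · obtain rfl : j = j' := by omega
      exact h2
  · intro i j
    rw [hun]
    refine (measureReal_mono fun ω hω => ?_).trans (measureReal_union_le _ _)
    rcases hpred hω with ⟨-, h1⟩ | ⟨i', h1, h2⟩ | ⟨j', h1, h2⟩
    · omega
    · obtain rfl : i = i' := by omega
      exact Or.inl h2
    · obtain rfl : j = j' := by omega
      exact Or.inr h2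

/-- The tail of the series of the reciprocal weights. -/
noncomputable def recipTail (w : ℕ → ℝ) (k : ℕ) : ENNReal :=
  ∑' j, ENNReal.ofReal (1 / w (k + j))

lemma tsum_comp_le_recipTail (w : ℕ → ℝ) {k : ℕ} {φ : ℕ → ℕ} (hφ : Function.Injective φ)
    (hk : ∀ i, k ≤ φ i) : ∑' i, ENNReal.ofReal (1 / w (φ i)) ≤ recipTail w k := by
  have : ∀ i, ENNReal.ofReal (1 / w (φ i)) =
      (fun j => ENNReal.ofReal (1 / w (k + j))) (φ i - k) := by
    intro i
    simp only
    rw [Nat.add_sub_cancel' (hk i)]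
  simp_rw [this]
  refine ENNReal.tsum_comp_le_tsum_of_injective (f := fun i => φ i - k) (fun i i' hii => hφ ?_)
    (fun j => ENNReal.ofReal (1 / w (k + j)))
  have := hk i
  have := hk i'
  simp only at hii
  omega

/-- The walk leaves `v` along `f` at a time when the weight of `e` is at least `K`. -/
def lateDepart (I : ℕ → Ω → V) (Y : ℕ → Ω → G.edgeSet) (K : ℕ) (v : V) (e f : G.edgeSet) : Set Ω :=
  {ω | ∃ n, I n ω = v ∧ Y n ω = f ∧ K ≤ edgeWeight (fun _ => 1) Y n e ω}

/-- If `f` was used fewer than `L` times before, sum over these `j < L` and over all large counts of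
`e`: this gives `L * recipTail w K`. Otherwise the counters have entered a quadrant, either by a
departure along `f` of the kind already counted or by one along `e` with `j ≥ L`, which gives
`recipTail w L`. -/
lemma IsERRW.measure_lateDepart_le [Countable V]
    (h : IsERRW (simpleEnds G) w (fun _ => 1) v₀ μ I Y) (hG : G.IsAcyclic)
    (hw : ∀ k, 1 ≤ k → 0 < w k) {v : V} {e f : G.edgeSet} (hef : e ≠ f) (hve : v ∈ (e : Sym2 V))
    (hvf : v ∈ (f : Sym2 V)) {K : ℕ} (hK : 3 ≤ K) (L : ℕ) :
    μ (lateDepart I Y K v e f) ≤ ENNReal.ofReal (w 1 + w 2) * μ (visits I v) *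
      (L * recipTail w K + recipTail w L) := by
  have := h.isProbabilityMeasure
  obtain ⟨a, ha1, ha⟩ := exists_edgeWeight_eq (Ω := Ω) hG v₀ v e hve
  obtain ⟨b, hb1, hb⟩ := exists_edgeWeight_eq (Ω := Ω) hG v₀ v f hvf
  have ha' : ∀ ω, IsTrajectory v₀ I Y ω → ∀ n, I n ω = v →
      edgeWeight (fun _ => 1) Y n e ω = a + 2 * outCount I Y v e n ω := fun ω hω => ha hω
  have hb' : ∀ ω, IsTrajectory v₀ I Y ω → ∀ n, I n ω = v →
      edgeWeight (fun _ => 1) Y n f ω = b + 2 * outCount I Y v f n ω := fun ω hω => hb hω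
  have hE := h.measureReal_depart_le hw hef hve hvf ha1 hb1 ha' hb'
  have hprop := h.measureReal_depart hve hvf ha' hb'
  set C := ENNReal.ofReal (w 1 + w 2) * μ (visits I v) with hC
  have hC' : C = ENNReal.ofReal ((w 1 + w 2) * μ.real (visits I v)) := by
    rw [ENNReal.ofReal_mul (by have := hw 1 le_rfl; have := hw 2 (by omega); positivity),
      ofReal_measureReal]
  have conv : ∀ {A : Set Ω} {x : ℝ}, 0 < x → x * μ.real A ≤ (w 1 + w 2) * μ.real (visits I v) →
      μ A ≤ C * ENNReal.ofReal (1 / x) := by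
    intro A x hx hA
    rw [hC', ← ENNReal.ofReal_mul' (by positivity), ← ofReal_measureReal (μ := μ) (s := A)]
    refine ENNReal.ofReal_le_ofReal ?_
    rw [mul_one_div, le_div_iff₀ hx, mul_comm]
    exact hA
  have hEb : ∀ i j, μ (depart I Y v e f e i j) ≤ C * ENNReal.ofReal (1 / w (b + 2 * j)) :=
    fun i j => conv (hw _ (by omega)) (hE i j)
  have hFb : ∀ i j, μ (depart I Y v e f f i j) ≤ C * ENNReal.ofReal (1 / w (a + 2 * i)) :=
    fun i j => conv (hw _ (by omega)) (by rw [← hprop]; exact hE i j)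
  -- `A + 1` is the least number of departures along `e` that brings its weight to `K`; `3 ≤ K` and
  -- `a ≤ 2` keep the subtraction from truncating.
  obtain ⟨A, hA⟩ : ∃ A, A = (K - a - 1) / 2 := ⟨_, rfl⟩
  have hsub : ∀ ω, IsTrajectory v₀ I Y ω → ω ∈ lateDepart I Y K v e f →
      ω ∈ (⋃ j ∈ Finset.range L, ⋃ i, depart I Y v e f f (A + 1 + i) j) ∪
        ⋃ j, depart I Y v e f e A (L + j) := by
    rintro ω hω ⟨n, h1, h2, h3⟩
    rw [ha' ω hω n h1] at h3
    have h4 : A + 1 ≤ outCount I Y v e n ω := by omega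
    have fin : ∀ i j, A + 1 ≤ i → j < L → ω ∈ depart I Y v e f f i j →
        ω ∈ (⋃ j ∈ Finset.range L, ⋃ i, depart I Y v e f f (A + 1 + i) j) ∪
        ⋃ j, depart I Y v e f e A (L + j) := by
      intro i j hi hj hm
      refine Or.inl ?_
      simp only [Set.mem_iUnion, Finset.mem_range]
      exact ⟨j, hj, i - (A + 1), by rwa [Nat.add_sub_cancel' hi]⟩
    rcases Nat.lt_or_ge (outCount I Y v f n ω) L with h5 | h5
    · exact fin _ _ h4 h5 (mem_depart.mpr ⟨n, h1, h2, rfl, rfl⟩)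
    · rcases exists_depart_enter hef h4 h5 with ⟨j, hj, hm⟩ | ⟨i, j, hi, hj, hm⟩
      · refine Or.inr (Set.mem_iUnion.mpr ⟨j - L, ?_⟩)
        rwa [Nat.add_sub_cancel' hj]
      · exact fin i j hi hj hm
  have h1 : μ (lateDepart I Y K v e f) ≤
      μ ((⋃ j ∈ Finset.range L, ⋃ i, depart I Y v e f f (A + 1 + i) j) ∪
        ⋃ j, depart I Y v e f e A (L + j)) :=
    measure_mono_ae (h.ae_isTrajectory.mono fun ω hω => hsub ω hω)
  have h2 : ∀ j ∈ Finset.range L, μ (⋃ i, depart I Y v e f f (A + 1 + i) j) ≤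
      C * recipTail w K := by
    intro j _
    calc μ (⋃ i, depart I Y v e f f (A + 1 + i) j)
        ≤ ∑' i, μ (depart I Y v e f f (A + 1 + i) j) := measure_iUnion_le _
      _ ≤ ∑' i, C * ENNReal.ofReal (1 / w (a + 2 * (A + 1 + i))) :=
        ENNReal.tsum_le_tsum fun i => hFb _ _
      _ ≤ C * recipTail w K := by
        rw [ENNReal.tsum_mul_left]
        gcongr
        exact tsum_comp_le_recipTail w (φ := fun i => a + 2 * (A + 1 + i))
          (fun i i' hii => by simp only at hii; omega) fun i => by omega
  have h3 : μ (⋃ j, depart I Y v e f e A (L + j)) ≤ C * recipTail w L := by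
    calc μ (⋃ j, depart I Y v e f e A (L + j))
        ≤ ∑' j, μ (depart I Y v e f e A (L + j)) := measure_iUnion_le _
      _ ≤ ∑' j, C * ENNReal.ofReal (1 / w (b + 2 * (L + j))) :=
        ENNReal.tsum_le_tsum fun i => hEb _ _
      _ ≤ C * recipTail w L := by
        rw [ENNReal.tsum_mul_left]
        gcongr
        exact tsum_comp_le_recipTail w (φ := fun j => b + 2 * (L + j))
          (fun i i' hii => by simp only at hii; omega) fun i => by omega
  calc μ (lateDepart I Y K v e f) ≤ _ := h1
    _ ≤ _ := measure_union_le _ _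
    _ ≤ ∑ j ∈ Finset.range L, μ (⋃ i, depart I Y v e f f (A + 1 + i) j) + C * recipTail w L :=
      add_le_add (measure_biUnion_finset_le _ _) h3
    _ ≤ ∑ j ∈ Finset.range L, C * recipTail w K + C * recipTail w L := by
      gcongr with j hj
      exact h2 j hj
    _ = C * (L * recipTail w K + recipTail w L) := by
      rw [Finset.sum_const, Finset.card_range, nsmul_eq_mul]; ring

end Competition

/-! ### Countability, degrees and inner vertices. -/

section Graph

variable {V : Type*} {G : SimpleGraph V}

/-- Finitely many vertices start a walk of length `n` to a fixed vertex. -/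
lemma countable_of_connected (hG : G.Connected) (hfin : ∀ v, (G.neighborSet v).Finite) :
    Countable V := by
  obtain ⟨v₀⟩ := hG.nonempty
  have hS : ∀ n, {v | ∃ p : G.Walk v v₀, p.length = n}.Finite := by
    intro n
    induction n with
    | zero =>
      refine (Set.finite_singleton v₀).subset ?_
      rintro v ⟨p, hp⟩
      exact SimpleGraph.Walk.eq_of_length_eq_zero hp
    | succ n ih =>
      refine (ih.biUnion fun u _ => hfin u).subset ?_
      rintro v ⟨p, hp⟩
      cases p with
      | nil => simp at hp
      | cons h p =>
        simp only [SimpleGraph.Walk.length_cons, Nat.add_right_cancel_iff] at hp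
        exact Set.mem_biUnion (x := _) ⟨p, hp⟩ h.symm
  rw [← Set.countable_univ_iff]
  refine (Set.countable_iUnion fun n => (hS n).countable).mono fun v _ => ?_
  obtain ⟨p⟩ := hG.preconnected v v₀
  exact Set.mem_iUnion.mpr ⟨p.length, p, rfl⟩

lemma encard_incident_le {v : V} {D : ℕ} (hD : (G.neighborSet v).encard ≤ D) :
    {e : G.edgeSet | v ∈ (e : Sym2 V)}.encard ≤ D := by
  classical
  refine le_trans ?_ hD
  rw [← Set.encard_congr (G.incidenceSetEquivNeighborSet v),
    ← Subtype.val_injective.encard_image]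
  refine Set.encard_le_encard ?_
  rintro _ ⟨e, he, rfl⟩
  exact ⟨e.2, he⟩

/-- A vertex with at least two neighbours. -/
def IsInner (G : SimpleGraph V) (v : V) : Prop := (G.neighborSet v).Nontrivial

/-- An edge between two leaves would be the whole connected graph. Hence a bound on the visited
inner vertices also bounds the traversed edges. -/
lemma exists_isInner_of_edge [Infinite V] (hG : G.Connected) (e : G.edgeSet) :
    ∃ v, v ∈ (e : Sym2 V) ∧ IsInner G v := by
  obtain ⟨e, he⟩ := e
  induction e with | h x y => ?_
  have hxy : G.Adj x y := he
  by_contra! hc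
  have hx : ∀ z, G.Adj x z → z = y := by
    intro z hz
    by_contra hne
    exact hc x (Sym2.mem_mk_left _ _) ⟨z, hz, y, hxy, hne⟩
  have hy : ∀ z, G.Adj y z → z = x := by
    intro z hz
    by_contra hne
    exact hc y (Sym2.mem_mk_right _ _) ⟨z, hz, x, hxy.symm, hne⟩
  have hall : ∀ v, v = x ∨ v = y := by
    have hwalk : ∀ {a b : V} (p : G.Walk a b), b = x → a = x ∨ a = y := by
      intro a b p hb
      induction p with
      | nil => exact Or.inl hb
      | cons h p ih =>
        rcases ih hb with h' | h'
        · rw [h'] at h; exact Or.inr (hx _ h.symm)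
        · rw [h'] at h; exact Or.inl (hy _ h.symm)
    intro v
    obtain ⟨p⟩ := hG.preconnected v x
    exact hwalk p rfl
  have : (Set.univ : Set V).Finite :=
    (Set.toFinite {x, y}).subset fun v _ => hall v
  exact Set.infinite_univ this

end Graph

/-! ### The number of inner vertices visited has a geometric tail. -/

section Sticking

variable {V Ω : Type*} {G : SimpleGraph V} {v₀ : V} {I : ℕ → Ω → V} {Y : ℕ → Ω → G.edgeSet}

/-- At time `n` the walk is for the first time at an inner vertex. -/
def NewInner (G : SimpleGraph V) (I : ℕ → Ω → V) (ω : Ω) (n : ℕ) : Prop :=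
  IsInner G (I n ω) ∧ ∀ i < n, I i ω ≠ I n ω

open Classical in
/-- The number of inner vertices visited before time `n`. -/
noncomputable def innerCount (G : SimpleGraph V) (I : ℕ → Ω → V) (n : ℕ) (ω : Ω) : ℕ :=
  Nat.count (NewInner G I ω) n

open Classical in
lemma innerCount_succ (n : ℕ) (ω : Ω) :
    innerCount G I (n + 1) ω = innerCount G I n ω + if NewInner G I ω n then 1 else 0 := by
  unfold innerCount
  rw [Nat.count_succ]

@[simp] lemma innerCount_zero (ω : Ω) : innerCount G I 0 ω = 0 := by simp [innerCount]

lemma innerCount_mono (ω : Ω) : Monotone fun n => innerCount G I n ω :=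
  monotone_nat_of_le_succ fun n => by rw [innerCount_succ]; exact Nat.le_add_right _ _

lemma newInner_congr {ω ω' : Ω} {n : ℕ} (h : ∀ i ≤ n, I i ω = I i ω') :
    NewInner G I ω n ↔ NewInner G I ω' n := by
  unfold NewInner
  rw [h n le_rfl]
  refine and_congr_right fun _ => forall₂_congr fun i hi => ?_
  rw [h i hi.le]

lemma innerCount_congr {ω ω' : Ω} {n : ℕ} (h : ∀ i < n, I i ω = I i ω') :
    innerCount G I n ω = innerCount G I n ω' := by
  induction n with
  | zero => simp
  | succ n ih =>
    rw [innerCount_succ, innerCount_succ, ih fun i hi => h i (by omega)]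
    classical
    exact congrArg _ (if_congr (newInner_congr fun i hi => h i (by omega)) rfl rfl)

lemma exists_innerCount_eq {ω : Ω} {m n : ℕ} (h : m + 1 ≤ innerCount G I n ω) :
    ∃ l < n, NewInner G I ω l ∧ innerCount G I l ω = m := by
  induction n with
  | zero => simp at h
  | succ n ih =>
    by_cases hn : m + 1 ≤ innerCount G I n ω
    · obtain ⟨l, hl, h'⟩ := ih hn
      exact ⟨l, by omega, h'⟩
    · rw [innerCount_succ] at h
      split_ifs at h with h'
      · exact ⟨n, by omega, h', by omega⟩
      · omega

lemma innerCount_lt {ω : Ω} {l n : ℕ} (h : NewInner G I ω l) (hl : l < n) :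
    innerCount G I l ω < innerCount G I n ω := by
  have h1 := innerCount_succ (G := G) (I := I) l ω
  rw [if_pos h] at h1
  have h2 := innerCount_mono (G := G) (I := I) ω (show l + 1 ≤ n from hl)
  simp only at h2
  omega

lemma newInner_unique {ω : Ω} {l l' m : ℕ} (h : NewInner G I ω l) (h' : NewInner G I ω l')
    (hm : innerCount G I l ω = m) (hm' : innerCount G I l' ω = m) : l = l' := by
  rcases lt_trichotomy l l' with hlt | heq | hlt
  · have := innerCount_lt h hlt; omega
  · exact heq
  · have := innerCount_lt h' hlt; omega

/-- The walk visits at least `m` inner vertices. -/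
def innerAtLeast (G : SimpleGraph V) (I : ℕ → Ω → V) (m : ℕ) : Set Ω :=
  {ω | ∃ n, m ≤ innerCount G I n ω}

/-- At time `n + 1` the walk arrives from `u` at `v`, its inner vertex number `m`. -/
def arrival (G : SimpleGraph V) (I : ℕ → Ω → V) (m n : ℕ) (u v : V) : Set Ω :=
  {ω | I n ω = u ∧ I (n + 1) ω = v ∧ NewInner G I ω (n + 1) ∧ innerCount G I (n + 1) ω + 1 = m}

/-- After the arrival at `v`, the walk makes `t` steps along `e`. -/
def stuck (I : ℕ → Ω → V) (Y : ℕ → Ω → G.edgeSet) (m n : ℕ) (u v : V) (e : G.edgeSet) (t : ℕ) :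
    Set Ω :=
  arrival G I m n u v ∩ {ω | ∀ l < t, Y (n + 1 + l) ω = e}

lemma measurableSet_stuck [Countable V] (m n : ℕ) (u v : V) (e : G.edgeSet) (t : ℕ) :
    MeasurableSet[past I Y (n + 1 + t)] (stuck I Y m n u v e t) := by
  refine measurableSet_past_of_forall _ _ _ _ fun ω ω' hI hY hω => ?_
  obtain ⟨⟨h1, h2, h3, h4⟩, h5⟩ := hω
  refine ⟨⟨?_, ?_, ?_, ?_⟩, fun l hl => ?_⟩
  · rw [← hI _ (by omega), h1]
  · rw [← hI _ (by omega), h2]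
  · exact (newInner_congr fun i hi => hI i (by omega)).mp h3
  · rw [← innerCount_congr fun i hi => hI i (by omega), h4]
  · rw [← hY _ (by omega)]; exact h5 l hl

lemma stuck_succ (m n : ℕ) (u v : V) (e : G.edgeSet) (t : ℕ) :
    stuck I Y m n u v e (t + 1) = stuck I Y m n u v e t ∩ Y (n + 1 + t) ⁻¹' {e} := by
  ext ω
  simp only [stuck, Set.mem_inter_iff, Set.mem_ofPred_eq, Set.mem_preimage,
    Set.mem_singleton_iff, and_assoc, Nat.lt_succ_iff_lt_or_eq]
  refine and_congr_right fun _ => ⟨fun h => ⟨fun l hl => h l (Or.inl hl), h t (Or.inr rfl)⟩, ?_⟩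
  rintro ⟨h1, h2⟩ l (hl | rfl)
  exacts [h1 l hl, h2]

lemma stuck_zero (m n : ℕ) (u v : V) (e : G.edgeSet) :
    stuck I Y m n u v e 0 = arrival G I m n u v := by
  simp [stuck]

lemma edgeWeight_add_of_forall_ne {ω : Ω} {n t : ℕ} {f : G.edgeSet}
    (h : ∀ l < t, Y (n + l) ω ≠ f) :
    edgeWeight (fun _ => 1) Y (n + t) f ω = edgeWeight (fun _ => 1) Y n f ω := by
  induction t with
  | zero => rfl
  | succ t ih =>
    rw [← add_assoc, edgeWeight_succ, if_neg (h t (by omega)), ih fun l hl => h l (by omega)]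
    rfl

lemma edgeWeight_eq_one {ω : Ω} {n : ℕ} {f : G.edgeSet} (h : ∀ l < n, Y l ω ≠ f) :
    edgeWeight (fun _ => 1) Y n f ω = 1 := by
  have := edgeWeight_add_of_forall_ne (n := 0) (t := n) (ω := ω) (f := f) (Y := Y) (by simpa using h)
  simpa using this

lemma edgeWeight_add_of_forall_eq {ω : Ω} {n t : ℕ} {f : G.edgeSet}
    (h : ∀ l < t, Y (n + l) ω = f) :
    edgeWeight (fun _ => 1) Y (n + t) f ω = edgeWeight (fun _ => 1) Y n f ω + t := by
  induction t with
  | zero => rfl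
  | succ t ih =>
    rw [← add_assoc, edgeWeight_succ, if_pos (h t (by omega)), ih fun l hl => h l (by omega)]
    rfl

lemma stuck_position {ω : Ω} (hω : IsTrajectory v₀ I Y ω) {m n : ℕ} {u v : V} {e : G.edgeSet}
    (hve : v ∈ (e : Sym2 V)) {t : ℕ} (hs : ω ∈ stuck I Y m n u v e t) :
    ∀ l ≤ t, I (n + 1 + l) ω ∈ (e : Sym2 V) := by
  rintro (_ | l) hl
  · rw [add_zero, hs.1.2.1]; exact hve
  · rw [← hs.2 l (by omega), ← add_assoc]
    exact hω.mem_edge' _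

/-- When the walk first arrives at `v`, the edges at `v` and those at the end `z` of an edge `e`
away from it have weight at most `2`, and `e` has weight `1`. -/
lemma arrival_weights (hG : G.IsAcyclic) {ω : Ω} (hω : IsTrajectory v₀ I Y ω) {m n : ℕ} {u v z : V}
    (hzu : z ≠ u) {e : G.edgeSet} (he : (e : Sym2 V) = s(v, z))
    (hA : ω ∈ arrival G I m n u v) :
    edgeWeight (fun _ => 1) Y (n + 1) e ω = 1 ∧
      ∀ x ∈ (e : Sym2 V), ∀ f : G.edgeSet, x ∈ (f : Sym2 V) → f ≠ e →
        edgeWeight (fun _ => 1) Y (n + 1) f ω = 1 ∨ edgeWeight (fun _ => 1) Y (n + 1) f ω = 2 := by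
  obtain ⟨h1, h2, h3, -⟩ := hA
  have hnew : ∀ i ≤ n, I i ω ≠ v := fun i hi => by rw [← h2]; exact h3.2 i (by omega)
  have hv : ∀ f : G.edgeSet, v ∈ (f : Sym2 V) → ∀ i < n, Y i ω ≠ f := by
    rintro f hf i hi rfl
    rw [hω.2 i, Sym2.mem_iff] at hf
    rcases hf with h | h
    · exact hnew i hi.le h.symm
    · exact hnew (i + 1) hi h.symm
  have hYn : Y n ω ≠ e := by
    intro h
    have h4 := hω.2 n
    rw [h, he, h1, h2, Sym2.eq_iff] at h4
    rcases h4 with ⟨h4, -⟩ | ⟨-, h4⟩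
    · exact hnew n le_rfl (h1.trans h4.symm)
    · exact hzu h4
  have hve : v ∈ (e : Sym2 V) := by rw [he]; exact Sym2.mem_mk_left _ _
  have hYe : ∀ i < n + 1, Y i ω ≠ e := by
    intro i hi
    rcases Nat.lt_succ_iff_lt_or_eq.mp hi with h | rfl
    · exact hv e hve i h
    · exact hYn
  refine ⟨edgeWeight_eq_one hYe, ?_⟩
  intro x hx f hf hfe
  rw [he, Sym2.mem_iff] at hx
  rcases hx with rfl | rfl
  -- At `v` only the edge of arrival has been traversed, and only once.
  · rw [edgeWeight_succ, edgeWeight_eq_one (hv f hf)]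
    split_ifs <;> simp
  · left
    -- The far end of `e` is unvisited, as `e` is a bridge that has not been crossed.
    have hbr : ¬ (G.deleteEdges {(e : Sym2 V)}).Reachable v x := by
      have hadj : G.Adj v x := by have := e.2; rwa [he] at this
      have := SimpleGraph.isAcyclic_iff_forall_adj_isBridge.mp hG hadj
      rw [SimpleGraph.isBridge_iff] at this
      rwa [he]
    have hz : ∀ i ≤ n + 1, I i ω ≠ x := by
      intro i hi hix
      have := hω.reachable_deleteEdges (e := e) hi fun l _ hl => hYe l hl
      rw [hix, h2] at this
      exact hbr this.symm
    refine edgeWeight_eq_one ?_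
    rintro i hi rfl
    rw [hω.2 i, Sym2.mem_iff] at hf
    rcases hf with h | h
    · exact hz i hi.le h.symm
    · exact hz (i + 1) hi h.symm

/-- Going to and fro along `e` shows the walk no new vertex except possibly `z`. -/
lemma stuck_innerCount {ω : Ω} (hω : IsTrajectory v₀ I Y ω) {m n : ℕ} {u v z : V} {e : G.edgeSet}
    (he : (e : Sym2 V) = s(v, z)) {t : ℕ} (hs : ω ∈ stuck I Y m n u v e t) :
    ∀ l ≤ t, innerCount G I (n + 1 + l + 1) ω ≤ m + 1 := by
  have hve : v ∈ (e : Sym2 V) := by rw [he]; exact Sym2.mem_mk_left _ _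
  have hpos := stuck_position hω hve hs
  have hv : I (n + 1) ω = v := hs.1.2.1
  have hm : innerCount G I (n + 1) ω + 1 = m := hs.1.2.2.2
  have h0 : innerCount G I (n + 1 + 1) ω ≤ m := by
    rw [innerCount_succ]; split_ifs <;> omega
  intro l hl
  rcases l with _ | l
  · exact h0.trans (Nat.le_succ _)
  · have hz : I (n + 1 + 1) ω = z := by
      have h1 := hω.2 (n + 1)
      have h2 : Y (n + 1) ω = e := hs.2 0 (by omega)
      rw [h2, he, hv] at h1
      exact (Sym2.congr_right.mp h1).symm
    induction l with
    | zero =>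
      change innerCount G I (n + 1 + 1 + 1) ω ≤ m + 1
      rw [innerCount_succ (n + 1 + 1)]
      split_ifs <;> omega
    | succ l ih =>
      rw [innerCount_succ, if_neg, add_zero]
      · exact ih (by omega)
      · rintro ⟨-, hnew⟩
        have := hpos (l + 1 + 1) hl
        rw [he, Sym2.mem_iff] at this
        rcases this with h | h
        · exact hnew (n + 1) (by omega) (hv.trans h.symm)
        · exact hnew (n + 1 + 1) (by omega) (hz.trans h.symm)

variable {w : ℕ → ℝ}

lemma stepProb_ge (hw : ∀ k, 1 ≤ k → 0 < w k) {D : ℕ} (hD : ∀ v, (G.neighborSet v).encard ≤ D)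
    {ω : Ω} {n : ℕ} {e : G.edgeSet} (he : I n ω ∈ (e : Sym2 V))
    (hf : ∀ f : G.edgeSet, I n ω ∈ (f : Sym2 V) → f ≠ e →
      edgeWeight (fun _ => 1) Y n f ω = 1 ∨ edgeWeight (fun _ => 1) Y n f ω = 2) :
    w (edgeWeight (fun _ => 1) Y n e ω) / (w (edgeWeight (fun _ => 1) Y n e ω) + D * (w 1 + w 2)) ≤
      stepProb (simpleEnds G) w (fun _ => 1) I Y n e ω := by
  classical
  have hcard := encard_incident_le (hD (I n ω))
  have hfin : {f : G.edgeSet | I n ω ∈ (f : Sym2 V)}.Finite :=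
    Set.finite_of_encard_le_coe hcard
  set F := hfin.toFinset with hF
  have hFD : F.card ≤ D := by
    rw [hfin.encard_eq_coe_toFinset_card] at hcard
    exact_mod_cast hcard
  have hpos : ∀ f : G.edgeSet, 0 < w (edgeWeight (fun _ => 1) Y n f ω) := fun f =>
    hw _ (le_edgeWeight (fun _ => 1) Y n f ω)
  have h1 := hw 1 le_rfl
  have h2 := hw 2 (by omega)
  unfold stepProb
  rw [if_pos (show I n ω ∈ simpleEnds G e from he)]
  have hsum : ∑ᶠ (f : G.edgeSet) (_ : I n ω ∈ simpleEnds G f), w (edgeWeight (fun _ => 1) Y n f ω) =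
      ∑ f ∈ F, w (edgeWeight (fun _ => 1) Y n f ω) :=
    finsum_mem_eq_finite_toFinset_sum _ hfin
  rw [hsum]
  have heF : e ∈ F := by rw [hF, Set.Finite.mem_toFinset]; exact he
  rw [← Finset.add_sum_erase _ _ heF]
  have hrest : ∑ f ∈ F.erase e, w (edgeWeight (fun _ => 1) Y n f ω) ≤ D * (w 1 + w 2) := by
    calc ∑ f ∈ F.erase e, w (edgeWeight (fun _ => 1) Y n f ω)
        ≤ (F.erase e).card • (w 1 + w 2) := by
          refine Finset.sum_le_card_nsmul _ _ _ fun f hfF => ?_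
          rw [Finset.mem_erase, hF, Set.Finite.mem_toFinset] at hfF
          rcases hf f hfF.2 hfF.1 with h | h <;> rw [h] <;> linarith
      _ ≤ D * (w 1 + w 2) := by
          rw [nsmul_eq_mul]
          have : ((F.erase e).card : ℝ) ≤ D := by
            exact_mod_cast (Finset.card_le_card (Finset.erase_subset _ _)).trans hFD
          gcongr
  have hs0 : 0 ≤ ∑ f ∈ F.erase e, w (edgeWeight (fun _ => 1) Y n f ω) :=
    Finset.sum_nonneg fun f _ => (hpos f).le
  have := hpos e
  gcongr

variable [MeasurableSpace Ω] {μ : Measure Ω}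

/-- After `t` steps `e` has weight `t + 1`, while its competitors contribute at most `D * (w 1 + w
2)`; the resulting product is bounded below uniformly in `t` by `exp_le_of_step`. -/
lemma IsERRW.le_measureReal_stuck [Countable V]
    (h : IsERRW (simpleEnds G) w (fun _ => 1) v₀ μ I Y) (hG : G.IsAcyclic)
    (hw : ∀ k, 1 ≤ k → 0 < w k) (hs : Summable fun k => 1 / w (k + 1)) {D : ℕ}
    (hD : ∀ v, (G.neighborSet v).encard ≤ D) {m n : ℕ} {u v z : V}
    (hzu : z ≠ u) {e : G.edgeSet} (he : (e : Sym2 V) = s(v, z)) (t : ℕ) :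
    Real.exp (-(D * (w 1 + w 2) * ∑' i, 1 / w (i + 1))) * μ.real (arrival G I m n u v) ≤
      μ.real (stuck I Y m n u v e t) := by
  have h1 := hw 1 le_rfl
  have h2 := hw 2 (by omega)
  have hve : v ∈ (e : Sym2 V) := by rw [he]; exact Sym2.mem_mk_left _ _
  have key := exp_le_of_step (a := fun k => w (k + 1)) (fun i => hw _ (by omega)) hs
    (s := D * (w 1 + w 2)) (by positivity) (x := fun t => μ.real (stuck I Y m n u v e t))
    measureReal_nonneg ?_ t
  · simpa only [stuck_zero] using key
  intro t
  rw [stuck_succ]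
  refine h.le_measureReal_inter_edge _ _ (measurableSet_stuck m n u v e t) _ ?_
  filter_upwards [h.ae_isTrajectory] with ω hω hωs
  obtain ⟨hw1, hw2⟩ := arrival_weights hG hω hzu he hωs.1
  have hpos := stuck_position hω hve hωs t le_rfl
  have hXe : edgeWeight (fun _ => 1) Y (n + 1 + t) e ω = t + 1 := by
    rw [edgeWeight_add_of_forall_eq hωs.2, hw1, add_comm]
  have := stepProb_ge (w := w) hw hD hpos (fun f hf hfe => by
    rw [edgeWeight_add_of_forall_ne (Y := Y) fun l hl => by rw [hωs.2 l hl]; exact hfe.symm]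
    exact hw2 _ hpos f hf hfe)
  rwa [hXe] at this

lemma IsERRW.measure_arrival_inter_le [Countable V]
    (h : IsERRW (simpleEnds G) w (fun _ => 1) v₀ μ I Y) (hG : G.IsAcyclic)
    (hw : ∀ k, 1 ≤ k → 0 < w k) (hs : Summable fun k => 1 / w (k + 1)) {D : ℕ}
    (hD : ∀ v, (G.neighborSet v).encard ≤ D) (m n : ℕ) (u v : V) :
    μ (arrival G I m n u v ∩ innerAtLeast G I (m + 2)) ≤
      ENNReal.ofReal (1 - Real.exp (-(D * (w 1 + w 2) * ∑' i, 1 / w (i + 1)))) *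
        μ (arrival G I m n u v) := by
  have := h.isProbabilityMeasure
  set δ := Real.exp (-(D * (w 1 + w 2) * ∑' i, 1 / w (i + 1))) with hδ
  by_cases hv : IsInner G v
  swap
  · have hemp : arrival G I m n u v = ∅ := by
      refine Set.eq_empty_of_forall_notMem fun ω hω => hv ?_
      have := hω.2.2.1.1
      rwa [hω.2.1] at this
    simp [hemp]
  -- An inner vertex has a neighbour other than the one the walk came from; the edge to it is still
  -- fresh.
  obtain ⟨z, hz, hzu⟩ := hv.exists_ne u
  set e : G.edgeSet := ⟨s(v, z), hz⟩ with he
  have hfin : ∀ t, μ (arrival G I m n u v ∩ {ω | m + 2 ≤ innerCount G I (n + 1 + t + 1) ω}) ≤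
      ENNReal.ofReal (1 - δ) * μ (arrival G I m n u v) := by
    intro t
    have h1 : μ (arrival G I m n u v ∩ {ω | m + 2 ≤ innerCount G I (n + 1 + t + 1) ω}) ≤
        μ (arrival G I m n u v \ stuck I Y m n u v e t) := by
      refine measure_mono_ae ?_
      filter_upwards [h.ae_isTrajectory] with ω hω hωm
      refine ⟨hωm.1, fun hst => ?_⟩
      have h2 := stuck_innerCount hω (z := z) rfl hst t le_rfl
      have h3 : m + 2 ≤ innerCount G I (n + 1 + t + 1) ω := hωm.2
      omega
    refine h1.trans ?_
    rw [← ofReal_measureReal, ← ofReal_measureReal (μ := μ) (s := arrival G I m n u v),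
      ← ENNReal.ofReal_mul' measureReal_nonneg]
    refine ENNReal.ofReal_le_ofReal ?_
    rw [measureReal_sdiff (show stuck I Y m n u v e t ⊆ arrival G I m n u v from
      Set.inter_subset_left) (h.past_le _ _ (measurableSet_stuck m n u v e t))]
    have := h.le_measureReal_stuck hG hw hs hD (m := m) (n := n) hzu (e := e) rfl t
    rw [← hδ] at this
    linarith
  have hU : arrival G I m n u v ∩ innerAtLeast G I (m + 2) =
      ⋃ t, arrival G I m n u v ∩ {ω | m + 2 ≤ innerCount G I (n + 1 + t + 1) ω} := by
    rw [← Set.inter_iUnion]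
    congr 1
    ext ω
    simp only [innerAtLeast, Set.mem_ofPred_eq, Set.mem_iUnion]
    constructor
    · rintro ⟨N, hN⟩
      exact ⟨N, hN.trans (innerCount_mono (G := G) (I := I) ω (by omega))⟩
    · rintro ⟨t, ht⟩
      exact ⟨_, ht⟩
  rw [hU, Monotone.measure_iUnion]
  · exact iSup_le hfin
  · intro t t' htt ω hω
    exact ⟨hω.1, (show m + 2 ≤ _ from hω.2).trans (innerCount_mono (G := G) (I := I) ω (by omega))⟩

lemma IsERRW.measure_innerAtLeast_add_two_le [Countable V]
    (h : IsERRW (simpleEnds G) w (fun _ => 1) v₀ μ I Y) (hG : G.IsAcyclic)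
    (hw : ∀ k, 1 ≤ k → 0 < w k) (hs : Summable fun k => 1 / w (k + 1)) {D : ℕ}
    (hD : ∀ v, (G.neighborSet v).encard ≤ D) {m : ℕ} (hm : 2 ≤ m) :
    μ (innerAtLeast G I (m + 2)) ≤
      ENNReal.ofReal (1 - Real.exp (-(D * (w 1 + w 2) * ∑' i, 1 / w (i + 1)))) *
        μ (innerAtLeast G I m) := by
  set κ := ENNReal.ofReal (1 - Real.exp (-(D * (w 1 + w 2) * ∑' i, 1 / w (i + 1)))) with hκ
  let A : ℕ × V × V → Set Ω := fun x => arrival G I m x.1 x.2.1 x.2.2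
  have hsub1 : innerAtLeast G I (m + 2) ⊆ ⋃ x, A x ∩ innerAtLeast G I (m + 2) := by
    rintro ω ⟨N, hN⟩
    obtain ⟨l, -, hl1, hl2⟩ := exists_innerCount_eq (G := G) (I := I) (ω := ω) (m := m - 1) (n := N)
      (by omega)
    -- As `2 ≤ m`, inner vertex number `m` is not the starting point, so there is a step arriving at
    -- it.
    rcases l with _ | l
    · rw [innerCount_zero] at hl2; omega
    · exact Set.mem_iUnion.mpr ⟨(l, I l ω, I (l + 1) ω), ⟨rfl, rfl, hl1,
        show innerCount G I (l + 1) ω + 1 = m by omega⟩, N, hN⟩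
  have hsub2 : ⋃ x, A x ⊆ innerAtLeast G I m := by
    refine Set.iUnion_subset ?_
    rintro ⟨n, u, v⟩ ω ⟨-, -, h3, h4⟩
    have h4 : innerCount G I (n + 1) ω + 1 = m := h4
    refine ⟨n + 1 + 1, ?_⟩
    rw [innerCount_succ, if_pos h3]
    omega
  have hmeas : ∀ x, MeasurableSet (A x) := by
    rintro ⟨n, u, v⟩
    refine h.measurableSet_of_forall (n + 1) _ fun ω ω' hI _ hω => ?_
    obtain ⟨h1, h2, h3, h4⟩ := hω
    refine ⟨?_, ?_, ?_, ?_⟩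
    · rw [← hI _ (by omega), h1]
    · rw [← hI _ (by omega), h2]
    · exact (newInner_congr fun i hi => hI i (by omega)).mp h3
    · rw [← innerCount_congr fun i hi => hI i (by omega), h4]
  have hdisj : Pairwise (Function.onFun Disjoint A) := by
    rintro ⟨n, u, v⟩ ⟨n', u', v'⟩ hne
    rw [Function.onFun, Set.disjoint_left]
    rintro ω ⟨h1, h2, h3, h4⟩ ⟨h1', h2', h3', h4'⟩
    have h4 : innerCount G I (n + 1) ω + 1 = m := h4
    have h4' : innerCount G I (n' + 1) ω + 1 = m := h4'
    have : n + 1 = n' + 1 := newInner_unique (m := m - 1) h3 h3' (by omega) (by omega)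
    obtain rfl : n = n' := by omega
    simp only at h1 h2 h1' h2'
    exact hne (by rw [← h1, ← h2, ← h1', ← h2'])
  calc μ (innerAtLeast G I (m + 2)) ≤ μ (⋃ x, A x ∩ innerAtLeast G I (m + 2)) :=
        measure_mono hsub1
    _ ≤ ∑' x, μ (A x ∩ innerAtLeast G I (m + 2)) := measure_iUnion_le _
    _ ≤ ∑' x, κ * μ (A x) :=
        ENNReal.tsum_le_tsum fun x => h.measure_arrival_inter_le hG hw hs hD _ _ _ _
    _ = κ * μ (⋃ x, A x) := by rw [ENNReal.tsum_mul_left, measure_iUnion hdisj hmeas]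
    _ ≤ κ * μ (innerAtLeast G I m) := by gcongr

lemma IsERRW.exists_measureReal_innerAtLeast_le [Countable V]
    (h : IsERRW (simpleEnds G) w (fun _ => 1) v₀ μ I Y) (hG : G.IsAcyclic)
    (hw : ∀ k, 1 ≤ k → 0 < w k) (hs : Summable fun k => 1 / w (k + 1)) {D : ℕ}
    (hD : ∀ v, (G.neighborSet v).encard ≤ D) :
    ∃ C γ : ℝ, 0 < C ∧ 0 < γ ∧ γ < 1 ∧ ∀ m, μ.real (innerAtLeast G I m) ≤ C * γ ^ m := by
  have := h.isProbabilityMeasure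
  set δ := Real.exp (-(D * (w 1 + w 2) * ∑' i, 1 / w (i + 1))) with hδ
  have hδ0 : 0 < δ := Real.exp_pos _
  have hδ1 : δ ≤ 1 := by
    rw [hδ, Real.exp_le_one_iff, neg_nonpos]
    have h1 := hw 1 le_rfl
    have h2 := hw 2 (by omega)
    have h3 : 0 ≤ ∑' i, 1 / w (i + 1) :=
      tsum_nonneg fun i => (div_pos one_pos (hw _ (by omega))).le
    positivity
  -- The root spreads a gain per two vertices over single ones; halving `δ` keeps `γ` positive even
  -- if `δ = 1`.
  set γ := Real.sqrt (1 - δ / 2) with hγ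
  have hγ2 : γ ^ 2 = 1 - δ / 2 := Real.sq_sqrt (by linarith)
  have hγ0 : 0 < γ := Real.sqrt_pos.mpr (by linarith)
  have hγ1 : γ < 1 := by
    rw [hγ, Real.sqrt_lt' one_pos]; linarith
  -- The constant makes the bound trivial for `m ≤ 3`, where the recursion in steps of two is not
  -- available.
  refine ⟨(γ ^ 3)⁻¹, γ, by positivity, hγ0, hγ1, fun m => ?_⟩
  have base : ∀ m ≤ 3, μ.real (innerAtLeast G I m) ≤ (γ ^ 3)⁻¹ * γ ^ m := by
    intro m hm
    refine measureReal_le_one.trans ?_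
    rw [← div_eq_inv_mul, one_le_div (by positivity)]
    exact pow_le_pow_of_le_one hγ0.le hγ1.le hm
  induction m using Nat.strong_induction_on with
  | _ m ih =>
    rcases Nat.lt_or_ge m 4 with hm | hm
    · exact base m (by omega)
    · obtain ⟨l, rfl⟩ : ∃ l, m = l + 2 := ⟨m - 2, by omega⟩
      have h1 := h.measure_innerAtLeast_add_two_le hG hw hs hD (m := l) (by omega)
      rw [← hδ, ← ofReal_measureReal, ← ofReal_measureReal (μ := μ) (s := innerAtLeast G I l),
        ← ENNReal.ofReal_mul' measureReal_nonneg, ENNReal.ofReal_le_ofReal_iff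
          (mul_nonneg (by linarith) measureReal_nonneg)] at h1
      calc μ.real (innerAtLeast G I (l + 2)) ≤ (1 - δ) * μ.real (innerAtLeast G I l) := h1
        _ ≤ γ ^ 2 * ((γ ^ 3)⁻¹ * γ ^ l) := by
          rw [hγ2]
          exact mul_le_mul (by linarith) (ih l (by omega)) measureReal_nonneg (by linarith)
        _ = (γ ^ 3)⁻¹ * γ ^ (l + 2) := by ring

/-- The expected number of inner vertices visited is finite. -/
lemma IsERRW.tsum_visits_ne_top [Countable V]
    (h : IsERRW (simpleEnds G) w (fun _ => 1) v₀ μ I Y) (hG : G.IsAcyclic)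
    (hw : ∀ k, 1 ≤ k → 0 < w k) (hs : Summable fun k => 1 / w (k + 1)) {D : ℕ}
    (hD : ∀ v, (G.neighborSet v).encard ≤ D) :
    ∑' v : {v // IsInner G v}, μ (visits I (v : V)) ≠ ⊤ := by
  have := h.isProbabilityMeasure
  obtain ⟨C, γ, hC, hγ0, hγ1, hb⟩ := h.exists_measureReal_innerAtLeast_le hG hw hs hD
  -- Inner vertices are sorted by the order of their first visits, so the mean is bounded by the sum
  -- over ranks of the geometric tails.
  let A : ℕ → {v // IsInner G v} → Set Ω := fun m v =>
    ⋃ n, {ω | I n ω = v ∧ NewInner G I ω n ∧ innerCount G I n ω = m}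
  have hmeas : ∀ m v, MeasurableSet (A m v) := fun m v => by
    refine MeasurableSet.iUnion fun n => h.measurableSet_of_forall n _ fun ω ω' hI _ hω => ?_
    obtain ⟨h1, h2, h3⟩ := hω
    refine ⟨?_, ?_, ?_⟩
    · rw [← hI _ le_rfl, h1]
    · exact (newInner_congr hI).mp h2
    · rw [← innerCount_congr fun i hi => hI i hi.le, h3]
  have hdisj : ∀ m, Pairwise (Function.onFun Disjoint (A m)) := by
    intro m v v' hne
    rw [Function.onFun, Set.disjoint_left]
    intro ω h1 h2
    obtain ⟨n, h1, h3, h4⟩ := Set.mem_iUnion.mp h1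
    obtain ⟨n', h1', h3', h4'⟩ := Set.mem_iUnion.mp h2
    obtain rfl := newInner_unique h3 h3' h4 h4'
    exact hne (Subtype.ext (h1.symm.trans h1'))
  have hvis : ∀ v : {v // IsInner G v}, visits I (v : V) ⊆ ⋃ m, A m v := by
    classical
    rintro ⟨v, hv⟩ ω hω
    have hω : ∃ n, I n ω = v := hω
    refine Set.mem_iUnion.mpr ⟨innerCount G I (Nat.find hω) ω, Set.mem_iUnion.mpr
      ⟨Nat.find hω, Nat.find_spec hω, ⟨?_, fun i hi => ?_⟩, rfl⟩⟩
    · rw [Nat.find_spec hω]; exact hv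
    · rw [Nat.find_spec hω]; exact Nat.find_min hω hi
  have hsub : ∀ m, ⋃ v, A m v ⊆ innerAtLeast G I m := by
    intro m
    refine Set.iUnion_subset fun v => Set.iUnion_subset fun n ω hω => ⟨n, hω.2.2.ge⟩
  have hbound : ∑' v : {v // IsInner G v}, μ (visits I (v : V)) ≤
      ∑' m, ENNReal.ofReal (C * γ ^ m) := by
    calc ∑' v : {v // IsInner G v}, μ (visits I (v : V))
        ≤ ∑' v, ∑' m, μ (A m v) := ENNReal.tsum_le_tsum fun v =>
          (measure_mono (hvis v)).trans (measure_iUnion_le _)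
      _ = ∑' m, ∑' v, μ (A m v) := ENNReal.tsum_comm
      _ = ∑' m, μ (⋃ v, A m v) := by
          congr 1 with m
          rw [measure_iUnion (hdisj m) (hmeas m)]
      _ ≤ ∑' m, ENNReal.ofReal (C * γ ^ m) := ENNReal.tsum_le_tsum fun m => by
          refine (measure_mono (hsub m)).trans ?_
          rw [← ofReal_measureReal]
          exact ENNReal.ofReal_le_ofReal (hb m)
  refine ne_top_of_le_ne_top ?_ hbound
  exact ((summable_geometric_of_lt_one hγ0.le hγ1).mul_left C).tsum_ofReal_ne_top

end Sticking

/-! ### Upper bound for the tail on the tree, with free parameters. -/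

section TreeTail

variable {V Ω : Type*} {G : SimpleGraph V} {v₀ : V} {I : ℕ → Ω → V} {Y : ℕ → Ω → G.edgeSet}

lemma exists_finset_incident {D : ℕ} (hD : ∀ v, (G.neighborSet v).encard ≤ D) :
    ∃ inc : V → Finset G.edgeSet, (∀ v e, e ∈ inc v ↔ v ∈ (e : Sym2 V)) ∧
      ∀ v, (inc v).card ≤ D := by
  have hfin : ∀ v, {f : G.edgeSet | v ∈ (f : Sym2 V)}.Finite := fun v =>
    Set.finite_of_encard_le_coe (encard_incident_le (hD v))
  refine ⟨fun v => (hfin v).toFinset, fun v e => by simp, fun v => ?_⟩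
  have := encard_incident_le (hD v)
  rw [(hfin v).encard_eq_coe_toFinset_card] at this
  exact_mod_cast this

open Classical in
lemma card_visited_le (n : ℕ) (ω : Ω) :
    (((Finset.range n).image fun i => I i ω).filter (IsInner G)).card ≤ innerCount G I n ω := by
  induction n with
  | zero => simp
  | succ n ih =>
    rw [Finset.range_add_one, Finset.image_insert, Finset.filter_insert, innerCount_succ]
    by_cases hn : NewInner G I ω n
    · rw [if_pos hn, if_pos hn.1]
      exact (Finset.card_insert_le _ _).trans (by omega)
    · rw [if_neg hn]
      split_ifs with hi
      · have hex : ∃ i < n, I i ω = I n ω := by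
          by_contra! hc
          exact hn ⟨hi, hc⟩
        obtain ⟨i, hin, hii⟩ := hex
        rw [Finset.insert_eq_of_mem]
        · exact ih
        · rw [Finset.mem_filter, Finset.mem_image]
          exact ⟨⟨i, Finset.mem_range.mpr hin, hii⟩, hi⟩
      · exact ih

lemma exists_last_traversal {ω : Ω} {K k : ℕ} (hK : 2 ≤ K) {e : G.edgeSet}
    (h : K ≤ edgeWeight (fun _ => 1) Y k e ω) :
    ∃ m < k, Y m ω = e ∧ K ≤ edgeWeight (fun _ => 1) Y (m + 1) e ω := by
  induction k with
  | zero => simp at h; omega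
  | succ k ih =>
    by_cases hY : Y k ω = e
    · exact ⟨k, by omega, hY, h⟩
    · rw [edgeWeight_succ, if_neg hY] at h
      obtain ⟨m, hm, h'⟩ := ih h
      exact ⟨m, by omega, h'⟩

/-- If the walk still changes its edge after time `k`, and has visited few inner vertices, then it
has left some edge of large weight for another one. -/
lemma exists_lateDepart [Infinite V] (hG : G.Connected) {D : ℕ}
    (hD : ∀ v, (G.neighborSet v).encard ≤ D) {ω : Ω} (hω : IsTrajectory v₀ I Y ω) {k K M : ℕ}
    (hk : 1 ≤ k) (hK : 2 ≤ K) (hM : ω ∉ innerAtLeast G I (M + 1)) (hDMK : M * D * K ≤ k)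
    (hT : ∃ n, k ≤ n ∧ Y n ω ≠ Y (n + 1) ω) :
    ∃ (v : V) (e f : G.edgeSet), IsInner G v ∧ v ∈ (e : Sym2 V) ∧ v ∈ (f : Sym2 V) ∧ e ≠ f ∧
      ω ∈ lateDepart I Y K v e f := by
  classical
  obtain ⟨inc, hinc, hcard⟩ := exists_finset_incident hD
  set T := (Finset.range k).image fun i => Y i ω with hTdef
  -- Each edge used has an inner endpoint among the at most `M` visited ones, each of degree at most
  -- `D`.
  have hTcard : T.card ≤ M * D := by
    set W := ((Finset.range (k + 1)).image fun i => I i ω).filter (IsInner G) with hW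
    have hsub : T ⊆ W.biUnion inc := by
      intro e he
      obtain ⟨i, hi, rfl⟩ := Finset.mem_image.mp he
      have hi := Finset.mem_range.mp hi
      obtain ⟨x, hx, hxi⟩ := exists_isInner_of_edge hG (Y i ω)
      refine Finset.mem_biUnion.mpr ⟨x, ?_, (hinc _ _).mpr hx⟩
      rw [hW, Finset.mem_filter, Finset.mem_image]
      refine ⟨?_, hxi⟩
      rw [hω.2 i, Sym2.mem_iff] at hx
      rcases hx with rfl | rfl
      · exact ⟨i, Finset.mem_range.mpr (by omega), rfl⟩
      · exact ⟨i + 1, Finset.mem_range.mpr (by omega), rfl⟩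
    have hWc : W.card ≤ M := by
      refine (card_visited_le (k + 1) ω).trans ?_
      by_contra! hc
      exact hM ⟨k + 1, hc⟩
    calc T.card ≤ (W.biUnion inc).card := Finset.card_le_card hsub
      _ ≤ W.card * D := Finset.card_biUnion_le_card_mul _ _ _ fun v _ => hcard v
      _ ≤ M * D := Nat.mul_le_mul_right _ hWc
  obtain ⟨e, -, he⟩ := Finset.exists_le_card_fiber_of_mul_le_card_of_maps_to
    (s := Finset.range k) (t := T) (f := fun i => Y i ω) (n := K)
    (fun i hi => Finset.mem_image_of_mem _ hi)
    ⟨Y 0 ω, Finset.mem_image_of_mem _ (Finset.mem_range.mpr hk)⟩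
    (by rw [Finset.card_range]; exact (Nat.mul_le_mul_right _ hTcard).trans hDMK)
  have hX : K ≤ edgeWeight (fun _ => 1) Y k e ω := by
    unfold edgeWeight
    exact he.trans (le_of_eq_of_le (by congr!) (Nat.le_add_left _ _))
  obtain ⟨m, hmk, hm, hmX⟩ := exists_last_traversal hK hX
  -- Otherwise the walk would follow `e` forever from time `m < k` on, against `hT`.
  have hleave : ∃ n, Y n ω = e ∧ K ≤ edgeWeight (fun _ => 1) Y (n + 1) e ω ∧ Y (n + 1) ω ≠ e := by
    by_contra! hc
    have hstay : ∀ l, Y (m + l) ω = e ∧ K ≤ edgeWeight (fun _ => 1) Y (m + l + 1) e ω := by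
      intro l
      induction l with
      | zero => exact ⟨hm, hmX⟩
      | succ l ih =>
        exact ⟨hc _ ih.1 ih.2, ih.2.trans (edgeWeight_mono _ _ _ _ (by omega))⟩
    obtain ⟨n, hn, hne⟩ := hT
    obtain ⟨l, rfl⟩ : ∃ l, n = m + l := ⟨n - m, by omega⟩
    exact hne ((hstay l).1.trans (hstay (l + 1)).1.symm)
  obtain ⟨n, hn1, hn2, hn3⟩ := hleave
  have hve : I (n + 1) ω ∈ (e : Sym2 V) := by rw [← hn1]; exact hω.mem_edge' n
  have hvf : I (n + 1) ω ∈ (Y (n + 1) ω : Sym2 V) := hω.mem_edge _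
  refine ⟨I (n + 1) ω, e, Y (n + 1) ω, ?_, hve, hvf, hn3.symm, n + 1, rfl, rfl, hn2⟩
  -- The edge changes at this vertex, so the positions before and after are two distinct neighbours
  -- of it.
  refine ⟨I n ω, (hω.adj n).symm, I (n + 1 + 1) ω, hω.adj (n + 1), fun heq => hn3 ?_⟩
  apply Subtype.ext
  rw [hω.2 (n + 1), ← hn1, hω.2 n, heq, Sym2.eq_swap]

variable [MeasurableSpace Ω] {w : ℕ → ℝ} {μ : Measure Ω}

/-- Either more than `M` inner vertices are visited, or `exists_lateDepart` applies at one of them.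
The union bound over the pairs of edges at `v` costs `D * D`, and the probabilities of visiting `v`
have a finite sum. -/
lemma IsERRW.exists_tail_le [Infinite V] (h : IsERRW (simpleEnds G) w (fun _ => 1) v₀ μ I Y)
    (hG : G.IsTree) (hw : ∀ k, 1 ≤ k → 0 < w k) (hs : Summable fun k => 1 / w (k + 1)) {D : ℕ}
    (hD : ∀ v, (G.neighborSet v).encard ≤ D) :
    ∃ C γ : ℝ, 0 < C ∧ 0 < γ ∧ γ < 1 ∧ ∀ k K M L : ℕ, 1 ≤ k → 3 ≤ K → M * D * K ≤ k →
      ENNReal.ofReal (tail μ 0 Y k) ≤ ENNReal.ofReal (C * γ ^ M) +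
        ENNReal.ofReal C * (L * recipTail w K + recipTail w L) := by
  classical
  have hprob := h.isProbabilityMeasure
  have hcount : Countable V := countable_of_connected hG.connected fun v =>
    Set.finite_of_encard_le_coe (hD v)
  obtain ⟨inc, hinc, hcard⟩ := exists_finset_incident hD
  obtain ⟨C, γ, hC, hγ0, hγ1, hb⟩ := h.exists_measureReal_innerAtLeast_le hG.isAcyclic hw hs hD
  have hvis := h.tsum_visits_ne_top hG.isAcyclic hw hs hD
  set S := ∑' v : {v // IsInner G v}, μ (visits I (v : V)) with hS
  set S' : ENNReal := D * D * (ENNReal.ofReal (w 1 + w 2) * S) with hS'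
  have hS't : S' ≠ ⊤ := by
    refine ENNReal.mul_ne_top (ENNReal.mul_ne_top ?_ ?_) (ENNReal.mul_ne_top ?_ hvis) <;> simp
  refine ⟨max C S'.toReal, γ, lt_max_of_lt_left hC, hγ0, hγ1, ?_⟩
  intro k K M L hk hK hMDK
  set R := L * recipTail w K + recipTail w L with hR
  have h1 : μ {ω | (k : ℕ∞) < attractionTime 0 Y ω} ≤ μ (innerAtLeast G I (M + 1) ∪
      ⋃ v : {v // IsInner G v}, ⋃ e ∈ inc v, ⋃ f ∈ (inc v).erase e, lateDepart I Y K v e f) := by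
    refine measure_mono_ae ?_
    filter_upwards [h.ae_isTrajectory] with ω hω hT
    by_cases hM : ω ∈ innerAtLeast G I (M + 1)
    · exact Or.inl hM
    right
    have hT' := (lt_attractionTime_iff 0 Y ω k).mp (by rw [Nat.zero_add]; exact hT)
    obtain ⟨v, e, f, hv, hve, hvf, hef, hl⟩ :=
      exists_lateDepart hG.connected hD hω hk (by omega) hM hMDK hT'
    refine Set.mem_iUnion.mpr ⟨⟨v, hv⟩, Set.mem_iUnion₂.mpr ⟨e, (hinc _ _).mpr hve,
      Set.mem_iUnion₂.mpr ⟨f, ?_, hl⟩⟩⟩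
    rw [Finset.mem_erase]
    exact ⟨hef.symm, (hinc _ _).mpr hvf⟩
  have h2 : ∀ v : {v // IsInner G v},
      μ (⋃ e ∈ inc v, ⋃ f ∈ (inc v).erase e, lateDepart I Y K v e f) ≤
        D * D * (ENNReal.ofReal (w 1 + w 2) * μ (visits I (v : V)) * R) := by
    intro v
    have hDc : ((inc v).card : ENNReal) ≤ D := by exact_mod_cast hcard v
    calc μ (⋃ e ∈ inc v, ⋃ f ∈ (inc v).erase e, lateDepart I Y K v e f)
        ≤ ∑ e ∈ inc v, μ (⋃ f ∈ (inc v).erase e, lateDepart I Y K v e f) :=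
          measure_biUnion_finset_le _ _
      _ ≤ ∑ e ∈ inc v, ∑ f ∈ (inc v).erase e, μ (lateDepart I Y K v e f) :=
          Finset.sum_le_sum fun e _ => measure_biUnion_finset_le _ _
      _ ≤ ∑ e ∈ inc v, ∑ f ∈ (inc v).erase e,
          ENNReal.ofReal (w 1 + w 2) * μ (visits I (v : V)) * R := by
          refine Finset.sum_le_sum fun e he => Finset.sum_le_sum fun f hf => ?_
          rw [Finset.mem_erase] at hf
          exact h.measure_lateDepart_le hG.isAcyclic hw hf.1.symm ((hinc _ _).mp he)
            ((hinc _ _).mp hf.2) hK L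
      _ ≤ ∑ e ∈ inc v, D * (ENNReal.ofReal (w 1 + w 2) * μ (visits I (v : V)) * R) := by
          refine Finset.sum_le_sum fun e he => ?_
          rw [Finset.sum_const, nsmul_eq_mul]
          refine mul_le_mul' (le_trans ?_ hDc) le_rfl
          exact_mod_cast Finset.card_le_card (Finset.erase_subset _ _)
      _ ≤ D * D * (ENNReal.ofReal (w 1 + w 2) * μ (visits I (v : V)) * R) := by
          rw [Finset.sum_const, nsmul_eq_mul, mul_assoc (D : ENNReal)]
          exact mul_le_mul' hDc le_rfl
  unfold tail
  rw [ofReal_measureReal]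
  refine h1.trans ((measure_union_le _ _).trans (add_le_add ?_ ?_))
  · rw [← ofReal_measureReal]
    refine ENNReal.ofReal_le_ofReal ((hb (M + 1)).trans ?_)
    have : γ ^ (M + 1) ≤ γ ^ M := pow_le_pow_of_le_one hγ0.le hγ1.le (Nat.le_succ M)
    exact mul_le_mul (le_max_left _ _) this (by positivity) (le_trans hC.le (le_max_left _ _))
  · calc μ (⋃ v : {v // IsInner G v}, ⋃ e ∈ inc v, ⋃ f ∈ (inc v).erase e, lateDepart I Y K v e f)
        ≤ ∑' v : {v // IsInner G v},
            μ (⋃ e ∈ inc v, ⋃ f ∈ (inc v).erase e, lateDepart I Y K v e f) := measure_iUnion_le _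
      _ ≤ ∑' v : {v // IsInner G v},
            D * D * (ENNReal.ofReal (w 1 + w 2) * μ (visits I (v : V)) * R) :=
          ENNReal.tsum_le_tsum h2
      _ = S' * R := by
          rw [ENNReal.tsum_mul_left, ENNReal.tsum_mul_right, ENNReal.tsum_mul_left, hS']
          ring
      _ ≤ ENNReal.ofReal (max C S'.toReal) * R := by
          gcongr
          rw [← ENNReal.ofReal_toReal hS't]
          exact ENNReal.ofReal_le_ofReal (by simp)

end TreeTail

/-! ### Estimates for power-log weights, and the order of the two-edge tail. -/

section PowerLog

lemma IsPowerLogWeight.exists_exponent {ρ : ℝ} {w : ℕ → ℝ} (hw : IsPowerLogWeight ρ w) :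
    ∃ α : ℝ, 0 ≤ α ∧ 0 < w 1 ∧ ∀ k : ℕ, 2 ≤ k → w k = (k : ℝ) ^ ρ * Real.log k ^ α := by
  rcases hw with h | ⟨α, hα, h1, h⟩
  · exact ⟨0, le_rfl, by rw [h 1 le_rfl]; simp, fun k hk => by rw [h k (by omega)]; simp⟩
  · exact ⟨α, hα.le, h1, h⟩

variable {ρ α : ℝ} {w : ℕ → ℝ}

lemma log_natCast_pos {k : ℕ} (hk : 2 ≤ k) : 0 < Real.log k :=
  Real.log_pos (by exact_mod_cast hk)

lemma weight_pos (h1 : 0 < w 1) (hw : ∀ k : ℕ, 2 ≤ k → w k = (k : ℝ) ^ ρ * Real.log k ^ α) (k : ℕ)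
    (hk : 1 ≤ k) : 0 < w k := by
  rcases Nat.lt_or_ge k 2 with h | h
  · obtain rfl : k = 1 := by omega
    exact h1
  · rw [hw k h]
    have := log_natCast_pos h
    have : (0 : ℝ) < k := by exact_mod_cast hk
    positivity

lemma weight_mono (hρ : 1 < ρ) (hα : 0 ≤ α)
    (hw : ∀ k : ℕ, 2 ≤ k → w k = (k : ℝ) ^ ρ * Real.log k ^ α) (a b : ℕ) (ha : 2 ≤ a)
    (hab : a ≤ b) : w a ≤ w b := by
  rw [hw a ha, hw b (ha.trans hab)]
  have h1 := log_natCast_pos ha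
  have h2 : (0 : ℝ) < a := by exact_mod_cast (by omega : 0 < a)
  have h3 : (a : ℝ) ≤ b := by exact_mod_cast hab
  have h4 := Real.log_le_log h2 h3
  gcongr

/-- The right side is the integral of the decreasing function `s * t ^ (-(s + 1))` over `[x, x +
1]`, the left side its value at the right end. -/
lemma rpow_neg_le_telescope {s x : ℝ} (hs : 0 < s) (hx : 0 < x) :
    s * (x + 1) ^ (-(s + 1)) ≤ x ^ (-s) - (x + 1) ^ (-s) := by
  have hx1 : 0 < x + 1 := by linarith
  have hy : 0 < x / (x + 1) := by positivity
  have h1 : x ^ (-s) = (x + 1) ^ (-s) * (x / (x + 1)) ^ (-s) := by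
    rw [← Real.mul_rpow hx1.le hy.le, mul_div_cancel₀ _ hx1.ne']
  have h2 : 1 + s * (x + 1)⁻¹ ≤ (x / (x + 1)) ^ (-s) := by
    rw [Real.rpow_def_of_pos hy]
    have h3 := Real.log_le_sub_one_of_pos hy
    have h4 : x / (x + 1) - 1 = -(x + 1)⁻¹ := by field_simp; ring
    rw [h4] at h3
    have h5 := Real.add_one_le_exp (Real.log (x / (x + 1)) * -s)
    nlinarith
  have h6 : (x + 1) ^ (-(s + 1)) = (x + 1) ^ (-s) * (x + 1)⁻¹ := by
    rw [neg_add, ← sub_eq_add_neg, Real.rpow_sub_one hx1.ne', div_eq_mul_inv]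
  rw [h1, h6]
  have h7 : 0 < (x + 1) ^ (-s) := Real.rpow_pos_of_pos hx1 _
  nlinarith [mul_le_mul_of_nonneg_left h2 h7.le]

lemma sum_rpow_neg_le {s x : ℝ} (hs : 0 < s) (hx : 0 < x) (n : ℕ) :
    s * ∑ j ∈ Finset.range n, (x + 1 + j) ^ (-(s + 1)) ≤ x ^ (-s) := by
  have key : s * ∑ j ∈ Finset.range n, (x + 1 + j) ^ (-(s + 1)) ≤ x ^ (-s) - (x + n) ^ (-s) := by
    induction n with
    | zero => simp
    | succ n ih =>
      rw [Finset.sum_range_succ, mul_add]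
      have := rpow_neg_le_telescope hs (show 0 < x + n by positivity)
      push_cast
      rw [show x + 1 + (n : ℝ) = x + n + 1 by ring, ← add_assoc]
      linarith
  have : 0 ≤ (x + n) ^ (-s) := by positivity
  linarith

lemma exists_recipTail_le (hρ : 1 < ρ) (hα : 0 ≤ α)
    (hw : ∀ k : ℕ, 2 ≤ k → w k = (k : ℝ) ^ ρ * Real.log k ^ α) :
    ∃ C > 0, ∀ K : ℕ, 2 ≤ K →
      recipTail w K ≤ ENNReal.ofReal (C * ((K : ℝ) ^ (1 - ρ) * Real.log K ^ (-α))) := by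
  have hs : 0 < ρ - 1 := by linarith
  -- The power of `1 / 2` pays for `K - 1 ≥ K / 2`, and `1 / (ρ - 1)` is the constant of the
  -- integral comparison.
  refine ⟨(1 / 2) ^ (1 - ρ) / (ρ - 1), by positivity, fun K hK => ?_⟩
  have hK2 : (2 : ℝ) ≤ K := by exact_mod_cast hK
  have hlog := log_natCast_pos hK
  refine ENNReal.tsum_le_of_sum_range_le fun n => ?_
  have hterm : ∀ j : ℕ, 1 / w (K + j) ≤ Real.log K ^ (-α) * ((K : ℝ) - 1 + 1 + j) ^ (-(ρ - 1 + 1)) := by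
    intro j
    have h1 : (K : ℝ) ≤ (K + j : ℕ) := by push_cast; linarith [Nat.cast_nonneg (α := ℝ) j]
    have h2 : Real.log K ^ α ≤ Real.log (K + j : ℕ) ^ α := by
      have := Real.log_le_log (by linarith) h1
      gcongr
    have h3 : (0 : ℝ) < ((K + j : ℕ) : ℝ) ^ ρ := Real.rpow_pos_of_pos (by linarith) _
    have h4 : 0 < Real.log K ^ α := Real.rpow_pos_of_pos hlog _
    rw [hw _ (by omega), Real.rpow_neg hlog.le,
      show (K : ℝ) - 1 + 1 + j = ((K + j : ℕ) : ℝ) by push_cast; ring, sub_add_cancel,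
      Real.rpow_neg (by linarith), ← mul_inv, one_div]
    refine inv_anti₀ (by positivity) ?_
    rw [mul_comm]
    gcongr
  have hnn : ∀ j : ℕ, 0 ≤ Real.log K ^ (-α) * ((K : ℝ) - 1 + 1 + j) ^ (-(ρ - 1 + 1)) := by
    intro j
    have : (0 : ℝ) ≤ (K : ℝ) - 1 + 1 + j := by linarith [Nat.cast_nonneg (α := ℝ) j]
    positivity
  calc ∑ j ∈ Finset.range n, ENNReal.ofReal (1 / w (K + j))
      ≤ ∑ j ∈ Finset.range n,
          ENNReal.ofReal (Real.log K ^ (-α) * ((K : ℝ) - 1 + 1 + j) ^ (-(ρ - 1 + 1))) :=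
        Finset.sum_le_sum fun j _ => ENNReal.ofReal_le_ofReal (hterm j)
    _ = ENNReal.ofReal (∑ j ∈ Finset.range n,
          Real.log K ^ (-α) * ((K : ℝ) - 1 + 1 + j) ^ (-(ρ - 1 + 1))) :=
        (ENNReal.ofReal_sum_of_nonneg fun j _ => hnn j).symm
    _ ≤ _ := by
        refine ENNReal.ofReal_le_ofReal ?_
        rw [← Finset.mul_sum]
        have h1 := sum_rpow_neg_le hs (show (0 : ℝ) < (K : ℝ) - 1 by linarith) n
        have h2 : ((K : ℝ) - 1) ^ (-(ρ - 1)) ≤ (1 / 2 * (K : ℝ)) ^ (-(ρ - 1)) :=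
          Real.rpow_le_rpow_of_nonpos (by linarith) (by linarith) (by linarith)
        rw [Real.mul_rpow (by norm_num) (by linarith), neg_sub] at h2
        have h3 := h1.trans (le_of_eq_of_le (congrArg _ (neg_sub ρ 1)) h2)
        rw [mul_comm, ← le_div_iff₀ hs] at h3
        have h4 : 0 ≤ Real.log K ^ (-α) := by positivity
        calc _ ≤ Real.log K ^ (-α) * ((1 / 2) ^ (1 - ρ) * (K : ℝ) ^ (1 - ρ) / (ρ - 1)) :=
              mul_le_mul_of_nonneg_left h3 h4
          _ = _ := by ring

lemma summable_one_div_weight (hρ : 1 < ρ) (hα : 0 ≤ α) (h1 : 0 < w 1)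
    (hw : ∀ k : ℕ, 2 ≤ k → w k = (k : ℝ) ^ ρ * Real.log k ^ α) :
    Summable fun k => 1 / w (k + 1) := by
  obtain ⟨C, -, hC⟩ := exists_recipTail_le hρ hα hw
  have h2 : recipTail w 2 ≠ ⊤ := ne_top_of_le_ne_top ENNReal.ofReal_ne_top (hC 2 le_rfl)
  have h3 := ENNReal.summable_toReal h2
  rw [← summable_nat_add_iff 1]
  refine h3.congr fun j => ?_
  rw [ENNReal.toReal_ofReal (one_div_pos.mpr (weight_pos h1 hw _ (by omega))).le]
  congr 2
  ring

lemma eventually_le_natCast_rpow {s : ℝ} (hs : 0 < s) (c : ℝ) :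
    ∀ᶠ k : ℕ in atTop, c ≤ (k : ℝ) ^ s :=
  ((tendsto_rpow_atTop hs).comp tendsto_natCast_atTop_atTop).eventually_ge_atTop c

lemma eventually_le_log (c : ℝ) : ∀ᶠ k : ℕ in atTop, c ≤ Real.log k :=
  (Real.tendsto_log_atTop.comp tendsto_natCast_atTop_atTop).eventually_ge_atTop c

/-- With `B` of order `k ^ σ` the quantities `k * B ^ ρ` and `k ^ ρ` have the same order, because `σ
* ρ = ρ - 1`. -/
lemma isBigO_tail_twoEdges (hρ : 1 < ρ) (hα : 0 ≤ α) (h1 : 0 < w 1)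
    (hw : ∀ k : ℕ, 2 ≤ k → w k = (k : ℝ) ^ ρ * Real.log k ^ α)
    {Ω : Type*} [MeasurableSpace Ω] {ν : Measure Ω} {J : ℕ → Ω → Fin 2} {Z : ℕ → Ω → Bool}
    (hZ : IsERRW twoEdges w (fun _ => 1) 0 ν J Z) :
    (fun k : ℕ => (k : ℝ) ^ (1 + (ρ - 1) / ρ - ρ) * Real.log k ^ (-α)) =O[atTop]
      fun k : ℕ => tail ν 2 Z k := by
  obtain ⟨c, hc, hle⟩ := exists_le_tail_twoEdges hZ (weight_pos h1 hw)
    (summable_one_div_weight hρ hα h1 hw) (weight_mono hρ hα hw)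
  set σ := (ρ - 1) / ρ with hσ
  have hσ0 : 0 < σ := div_pos (by linarith) (by linarith)
  have hσ1 : σ ≤ 1 := by rw [hσ, div_le_one (by linarith)]; linarith
  have hσρ : σ * ρ = ρ - 1 := by rw [hσ]; field_simp
  refine IsBigO.of_bound (24 * (2 ^ ρ * 2 ^ α) / c) ?_
  filter_upwards [eventually_ge_atTop 12, eventually_le_natCast_rpow hσ0 24] with k hk hkσ
  have hk12 : (12 : ℝ) ≤ k := by exact_mod_cast hk
  have hk0 : (0 : ℝ) < k := by linarith
  have hlogk := log_natCast_pos (show 2 ≤ k by omega)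
  set x := (k : ℝ) ^ σ with hx
  have hxk : x ≤ k := by
    calc x ≤ (k : ℝ) ^ (1 : ℝ) := Real.rpow_le_rpow_of_exponent_le (by linarith) hσ1
      _ = k := Real.rpow_one _
  -- With `24 ≤ x` this gives `B + 1 ≤ x / 6`; against `k / 2 ≥ k / 3` for the integer quotient
  -- there remains the factor `(1 / 2) ^ ρ ≤ 1 / 2` that `hle` requires.
  set B := ⌊x / 12⌋₊ with hB
  have hB1 : (B : ℝ) ≤ x / 12 := Nat.floor_le (by positivity)
  have hB2 : x / 12 < B + 1 := Nat.lt_floor_add_one _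
  have hB3 : x / 24 ≤ B := by linarith
  have hBpos : 1 ≤ B := Nat.le_floor (by push_cast; linarith)
  have hB6 : ((B + 1 : ℕ) : ℝ) ≤ x / 6 := by push_cast; linarith
  have hB6' : 6 * (B + 1) ≤ k := by
    have : (6 : ℝ) * ((B + 1 : ℕ) : ℝ) ≤ k := by linarith
    exact_mod_cast this
  have hh3 : (k : ℝ) / 3 ≤ (k / 2 : ℕ) := by
    have : k ≤ 3 * (k / 2) := by omega
    have : (k : ℝ) ≤ 3 * (k / 2 : ℕ) := by exact_mod_cast this
    linarith
  have hkey : (k : ℝ) * w (B + 1) ≤ 1 / 2 * w (k / 2) := by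
    rw [hw (B + 1) (by omega), hw (k / 2) (by omega)]
    have hl1 : Real.log (B + 1 : ℕ) ≤ Real.log (k / 2 : ℕ) :=
      Real.log_le_log (by positivity) (by exact_mod_cast (by omega : B + 1 ≤ k / 2))
    have hl0 := log_natCast_pos (show 2 ≤ B + 1 by omega)
    have hl2 : Real.log (B + 1 : ℕ) ^ α ≤ Real.log (k / 2 : ℕ) ^ α := by gcongr
    have hp : (k : ℝ) * ((B + 1 : ℕ) : ℝ) ^ ρ ≤ 1 / 2 * ((k / 2 : ℕ) : ℝ) ^ ρ := by
      have e1 : ((B + 1 : ℕ) : ℝ) ^ ρ ≤ (x / 6) ^ ρ := by gcongr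
      have e2 : ((k : ℝ) / 3) ^ ρ ≤ ((k / 2 : ℕ) : ℝ) ^ ρ := by gcongr
      have e3 : x ^ ρ = (k : ℝ) ^ ρ / k := by
        rw [hx, ← Real.rpow_mul hk0.le, hσρ, Real.rpow_sub_one hk0.ne']
      have e4 : (k : ℝ) * (x / 6) ^ ρ = (1 / 2) ^ ρ * ((k : ℝ) / 3) ^ ρ := by
        rw [show x / 6 = 1 / 2 * (1 / 3) * x by ring, Real.mul_rpow (by norm_num) (by positivity),
          e3, Real.mul_rpow (by norm_num) (by norm_num), show (k : ℝ) / 3 = 1 / 3 * k by ring,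
          Real.mul_rpow (by norm_num) hk0.le]
        field_simp
      have e5 : ((1 : ℝ) / 2) ^ ρ ≤ 1 / 2 := by
        calc ((1 : ℝ) / 2) ^ ρ ≤ (1 / 2) ^ (1 : ℝ) :=
              Real.rpow_le_rpow_of_exponent_ge (by norm_num) (by norm_num) hρ.le
          _ = 1 / 2 := Real.rpow_one _
      calc (k : ℝ) * ((B + 1 : ℕ) : ℝ) ^ ρ ≤ k * (x / 6) ^ ρ := by gcongr
        _ = (1 / 2) ^ ρ * ((k : ℝ) / 3) ^ ρ := e4
        _ ≤ 1 / 2 * ((k / 2 : ℕ) : ℝ) ^ ρ := by gcongr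
    calc (k : ℝ) * (((B + 1 : ℕ) : ℝ) ^ ρ * Real.log (B + 1 : ℕ) ^ α)
        = (k : ℝ) * ((B + 1 : ℕ) : ℝ) ^ ρ * Real.log (B + 1 : ℕ) ^ α := by ring
      _ ≤ 1 / 2 * ((k / 2 : ℕ) : ℝ) ^ ρ * Real.log (k / 2 : ℕ) ^ α := by gcongr
      _ = _ := by ring
  have htail := hle k B (k / 2) (by omega) (by omega) hkey
  have hw2 : w (2 * k) ≤ 2 ^ ρ * 2 ^ α * ((k : ℝ) ^ ρ * Real.log k ^ α) := by
    rw [hw _ (by omega)]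
    push_cast
    have hl : Real.log (2 * k) ≤ 2 * Real.log k := by
      rw [Real.log_mul (by norm_num) hk0.ne']
      have := Real.log_le_log (by norm_num) (show (2 : ℝ) ≤ k by linarith)
      linarith
    have hl0 : 0 ≤ Real.log (2 * k) := Real.log_nonneg (by linarith)
    have : Real.log (2 * k) ^ α ≤ 2 ^ α * Real.log k ^ α := by
      rw [← Real.mul_rpow (by norm_num) hlogk.le]
      gcongr
    rw [Real.mul_rpow (by norm_num) hk0.le]
    calc 2 ^ ρ * (k : ℝ) ^ ρ * Real.log (2 * k) ^ α
        ≤ 2 ^ ρ * (k : ℝ) ^ ρ * (2 ^ α * Real.log k ^ α) := by gcongr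
      _ = _ := by ring
  have hw2pos : 0 < w (2 * k) := weight_pos h1 hw _ (by omega)
  have hLpos : 0 < Real.log k ^ α := by positivity
  have hpow : (k : ℝ) ^ (1 + σ - ρ) = k * x / (k : ℝ) ^ ρ := by
    rw [Real.rpow_sub hk0, Real.rpow_add hk0, Real.rpow_one]
  rw [Real.norm_of_nonneg (by positivity),
    Real.norm_of_nonneg (show 0 ≤ tail ν 2 Z k from measureReal_nonneg), hpow,
    Real.rpow_neg hlogk.le]
  have hfin : c * (x / 24 * k / (2 ^ ρ * 2 ^ α * ((k : ℝ) ^ ρ * Real.log k ^ α))) ≤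
      tail ν 2 Z k := by
    refine le_trans ?_ htail
    gcongr
  calc k * x / (k : ℝ) ^ ρ * (Real.log k ^ α)⁻¹
      = 24 * (2 ^ ρ * 2 ^ α) / c *
        (c * (x / 24 * k / (2 ^ ρ * 2 ^ α * ((k : ℝ) ^ ρ * Real.log k ^ α)))) := by
        field_simp
    _ ≤ _ := by gcongr

end PowerLog

/-! ### Choice of parameters and the order of the tree tail. -/

section Asymptotics

variable {ρ α : ℝ} {w : ℕ → ℝ}

lemma eventually_log_rpow_le {s : ℝ} (hs : 0 < s) (r c : ℝ) :
    ∀ᶠ k : ℕ in atTop, c * Real.log k ^ r ≤ (k : ℝ) ^ s := by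
  have h := ((isLittleO_log_rpow_rpow_atTop r hs).comp_tendsto
    tendsto_natCast_atTop_atTop).def (show 0 < (|c| + 1)⁻¹ by positivity)
  filter_upwards [h, eventually_ge_atTop 2] with k hk hk2
  have h1 : 0 ≤ Real.log k ^ r := (Real.rpow_pos_of_pos (log_natCast_pos hk2) _).le
  have h2 : (0 : ℝ) ≤ (k : ℝ) ^ s := by positivity
  simp only [Function.comp] at hk
  rw [Real.norm_of_nonneg h1, Real.norm_of_nonneg h2, inv_mul_eq_div,
    le_div_iff₀ (by positivity)] at hk
  refine le_trans ?_ hk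
  nlinarith [le_abs_self c]

/-- In `IsERRW.exists_tail_le` take `M` of order `log k`, which makes the geometric term negligible,
and `K` of order `k / log k`. Then `L` of order `k ^ σ` balances the powers of `k` in the other two
terms, as `σ + 1 - ρ = σ * (1 - ρ)`. -/
lemma isBigO_tail_tree {V Ω : Type*} [MeasurableSpace Ω] [Infinite V] {G : SimpleGraph V}
    (hG : G.IsTree) {D : ℕ} (hD : ∀ v : V, (G.neighborSet v).encard ≤ D)
    (hρ : 1 < ρ) (hα : 0 ≤ α) (h1 : 0 < w 1)
    (hw : ∀ k : ℕ, 2 ≤ k → w k = (k : ℝ) ^ ρ * Real.log k ^ α)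
    {v₀ : V} {μ : Measure Ω} {I : ℕ → Ω → V} {Y : ℕ → Ω → G.edgeSet}
    (hY : IsERRW (simpleEnds G) w (fun _ => 1) v₀ μ I Y) {q : ℝ} (hq : ρ - 1 ≤ q) :
    (fun k : ℕ => tail μ 0 Y k) =O[atTop]
      fun k : ℕ => (k : ℝ) ^ (1 + (ρ - 1) / ρ - ρ) * Real.log k ^ (-α) * Real.log k ^ q := by
  -- `D + 1` makes the divisor in the definition of `K` positive.
  have hD' : ∀ v : V, (G.neighborSet v).encard ≤ (D + 1 : ℕ) := fun v =>
    (hD v).trans (by exact_mod_cast Nat.le_succ D)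
  obtain ⟨C, γ, hC, hγ0, hγ1, htail⟩ := hY.exists_tail_le hG (weight_pos h1 hw)
    (summable_one_div_weight hρ hα h1 hw) hD'
  obtain ⟨C₁, hC₁, hrec⟩ := exists_recipTail_le hρ hα hw
  set σ := (ρ - 1) / ρ with hσ
  have hσ0 : 0 < σ := div_pos (by linarith) (by linarith)
  have hσρ : σ * (1 - ρ) = 1 + σ - ρ := by rw [hσ]; field_simp; ring
  have hlγ : Real.log γ < 0 := Real.log_neg hγ0 hγ1
  -- Chosen so that `γ ^ (A * log k) = k ^ (-ρ)`.
  set A := ρ / (-Real.log γ) with hA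
  have hA0 : 0 < A := div_pos (by linarith) (by linarith)
  have hAγ : Real.log γ * A = -ρ := by
    have := hlγ.ne
    rw [hA]; field_simp
  -- One factor `2` absorbs the rounding up of `M`, the other the rounding down of `K`, so that `k /
  -- (b * l) ≤ K`.
  set b := 4 * A * (D + 1 : ℕ) with hb
  have hb0 : 0 < b := by positivity
  refine IsBigO.of_bound (C + C * (2 * (C₁ * (b ^ (ρ - 1) * (1 / 2) ^ (-α))) + C₁ * σ ^ (-α))) ?_
  filter_upwards [eventually_ge_atTop 9, eventually_le_natCast_rpow hσ0 2, eventually_le_log 1,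
    eventually_le_log (1 / A), eventually_log_rpow_le one_pos α 1,
    eventually_log_rpow_le (show (0 : ℝ) < 1 / 2 by norm_num) 1 b] with k hk hkσ hl1 hlA hlα hlb
  have hk9 : (9 : ℝ) ≤ k := by exact_mod_cast hk
  have hk0 : (0 : ℝ) < k := by linarith
  set l := Real.log k with hl
  have hl0 : 0 < l := by linarith
  rw [Real.rpow_one, one_mul] at hlα
  rw [Real.rpow_one] at hlb
  set x := (k : ℝ) ^ σ with hx
  have hx0 : 0 < x := by positivity
  set s := (k : ℝ) ^ ((1 : ℝ) / 2) with hs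
  have hs0 : 0 < s := by positivity
  have hss : s * s = k := by
    rw [hs, ← Real.rpow_add hk0]; norm_num
  have hs3 : 3 ≤ s := by nlinarith
  have hlogs : Real.log s = 1 / 2 * l := by rw [hs, Real.log_rpow hk0]
  set g := (k : ℝ) ^ (1 + σ - ρ) * l ^ (-α) * l ^ q with hg
  have hg0 : 0 < g := by positivity
  have hlq : 1 ≤ l ^ q := Real.one_le_rpow hl1 (by linarith)
  have hlq' : l ^ (ρ - 1) ≤ l ^ q := Real.rpow_le_rpow_of_exponent_le hl1 hq
  have hkx : (k : ℝ) ^ (1 - ρ) * x = (k : ℝ) ^ (1 + σ - ρ) := by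
    rw [hx, ← Real.rpow_add hk0]; congr 1; ring
  -- the number of inner vertices
  set M := ⌈A * l⌉₊ with hM
  have hAl : 1 ≤ A * l := by
    rw [div_le_iff₀ hA0] at hlA; linarith
  have hM1 : A * l ≤ M := Nat.le_ceil _
  have hM2 : (M : ℝ) ≤ 2 * (A * l) := by
    have := Nat.ceil_lt_add_one (show 0 ≤ A * l by positivity)
    rw [← hM] at this
    linarith
  have hγM : γ ^ M ≤ g := by
    have e1 : γ ^ M ≤ (k : ℝ) ^ (-ρ) := by
      rw [← Real.rpow_natCast]
      calc γ ^ (M : ℝ) ≤ γ ^ (A * l) := Real.rpow_le_rpow_of_exponent_ge hγ0 hγ1.le hM1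
        _ = (k : ℝ) ^ (-ρ) := by
          rw [Real.rpow_def_of_pos hγ0, Real.rpow_def_of_pos hk0, ← mul_assoc, hAγ, ← hl, mul_comm]
    have e2 : (k : ℝ) ^ (-ρ) = (k : ℝ) ^ (1 - ρ) * (k : ℝ)⁻¹ := by
      rw [← Real.rpow_neg_one, ← Real.rpow_add hk0]; congr 1; ring
    have e3 : (k : ℝ)⁻¹ ≤ l ^ (-α) := by
      rw [Real.rpow_neg hl0.le]
      exact inv_anti₀ (by positivity) hlα
    have e4 : (k : ℝ) ^ (1 - ρ) ≤ (k : ℝ) ^ (1 + σ - ρ) :=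
      Real.rpow_le_rpow_of_exponent_le (by linarith) (by linarith)
    calc γ ^ M ≤ (k : ℝ) ^ (1 - ρ) * (k : ℝ)⁻¹ := e1.trans e2.le
      _ ≤ (k : ℝ) ^ (1 + σ - ρ) * l ^ (-α) := by gcongr
      _ ≤ g := le_mul_of_one_le_right (by positivity) hlq
  -- the weight of the heavy edge
  have hMD : 0 < M * (D + 1) := by
    have : 0 < M := Nat.ceil_pos.mpr (by positivity)
    positivity
  set K := k / (M * (D + 1)) with hK
  have hKk : M * (D + 1) * K ≤ k := Nat.mul_div_le _ _
  have hbl : 0 < b * l := by positivity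
  have hsk : s ≤ k / (b * l) := by
    rw [le_div_iff₀ hbl, ← hss]
    gcongr
  have hKb : (k : ℝ) / (b * l) ≤ K := by
    have e1 : (k : ℝ) < (M * (D + 1) : ℕ) * (K + 1) := by
      exact_mod_cast Nat.lt_mul_div_succ k hMD
    have e2 : ((M * (D + 1) : ℕ) : ℝ) ≤ b * l / 2 := by
      rw [Nat.cast_mul]
      calc (M : ℝ) * (D + 1 : ℕ) ≤ 2 * (A * l) * (D + 1 : ℕ) := by gcongr
        _ = b * l / 2 := by rw [hb]; ring
    have e3 : (k : ℝ) < b * l / 2 * (K + 1) := e1.trans_le (by gcongr)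
    have e4 : 2 * ((k : ℝ) / (b * l)) < K + 1 := by
      rw [← mul_div_assoc, div_lt_iff₀ hbl]
      linarith
    linarith
  have hKs : s ≤ K := hsk.trans hKb
  have hK3 : 3 ≤ K := by
    have : (3 : ℝ) ≤ K := hs3.trans hKs
    exact_mod_cast this
  have hrK : (K : ℝ) ^ (1 - ρ) * Real.log K ^ (-α) ≤
      b ^ (ρ - 1) * (1 / 2) ^ (-α) * ((k : ℝ) ^ (1 - ρ) * l ^ (-α) * l ^ (ρ - 1)) := by
    have e1 : (K : ℝ) ^ (1 - ρ) ≤ ((k : ℝ) / (b * l)) ^ (1 - ρ) :=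
      Real.rpow_le_rpow_of_nonpos (by positivity) hKb (by linarith)
    have e2 : ((k : ℝ) / (b * l)) ^ (1 - ρ) = (k : ℝ) ^ (1 - ρ) * (b ^ (ρ - 1) * l ^ (ρ - 1)) := by
      rw [Real.div_rpow hk0.le hbl.le, ← Real.mul_rpow hb0.le hl0.le, div_eq_mul_inv,
        ← Real.rpow_neg hbl.le, neg_sub]
    have e3 : Real.log K ^ (-α) ≤ (1 / 2 * l) ^ (-α) := by
      refine Real.rpow_le_rpow_of_nonpos (by positivity) ?_ (by linarith)
      rw [← hlogs]
      exact Real.log_le_log hs0 hKs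
    rw [Real.mul_rpow (by norm_num) hl0.le] at e3
    have e5 := Real.log_natCast_nonneg K
    calc (K : ℝ) ^ (1 - ρ) * Real.log K ^ (-α)
        ≤ (k : ℝ) ^ (1 - ρ) * (b ^ (ρ - 1) * l ^ (ρ - 1)) * ((1 / 2) ^ (-α) * l ^ (-α)) :=
          mul_le_mul (e1.trans e2.le) e3 (by positivity) (by positivity)
      _ = _ := by ring
  -- the weight of the light edge
  set L := ⌈x⌉₊ with hL
  have hL1 : x ≤ L := Nat.le_ceil _
  have hL2 : (L : ℝ) ≤ 2 * x := by
    have := Nat.ceil_lt_add_one hx0.le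
    rw [← hL] at this
    linarith
  have hL3 : 2 ≤ L := by
    have : (2 : ℝ) ≤ L := hkσ.trans hL1
    exact_mod_cast this
  have hrL : (L : ℝ) ^ (1 - ρ) * Real.log L ^ (-α) ≤ σ ^ (-α) * g := by
    have e1 : (L : ℝ) ^ (1 - ρ) ≤ x ^ (1 - ρ) :=
      Real.rpow_le_rpow_of_nonpos hx0 hL1 (by linarith)
    have e2 : x ^ (1 - ρ) = (k : ℝ) ^ (1 + σ - ρ) := by
      rw [hx, ← Real.rpow_mul hk0.le, hσρ]
    have e3 : Real.log L ^ (-α) ≤ (σ * l) ^ (-α) := by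
      refine Real.rpow_le_rpow_of_nonpos (by positivity) ?_ (by linarith)
      rw [← Real.log_rpow hk0]
      exact Real.log_le_log hx0 hL1
    rw [Real.mul_rpow hσ0.le hl0.le] at e3
    have e5 := Real.log_natCast_nonneg L
    calc (L : ℝ) ^ (1 - ρ) * Real.log L ^ (-α)
        ≤ (k : ℝ) ^ (1 + σ - ρ) * (σ ^ (-α) * l ^ (-α)) :=
          mul_le_mul (e1.trans e2.le) e3 (by positivity) (by positivity)
      _ = σ ^ (-α) * ((k : ℝ) ^ (1 + σ - ρ) * l ^ (-α)) := by ring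
      _ ≤ σ ^ (-α) * g := by
          have : (k : ℝ) ^ (1 + σ - ρ) * l ^ (-α) ≤ g :=
            le_mul_of_one_le_right (by positivity) hlq
          gcongr
  set rK := (K : ℝ) ^ (1 - ρ) * Real.log K ^ (-α) with hrKdef
  set rL := (L : ℝ) ^ (1 - ρ) * Real.log L ^ (-α) with hrLdef
  have hrK0 : 0 ≤ rK := by
    have := Real.log_natCast_nonneg K
    positivity
  have hrL0 : 0 ≤ rL := by
    have := Real.log_natCast_nonneg L
    positivity
  have hreal : tail μ 0 Y k ≤ C * γ ^ M + C * (L * (C₁ * rK) + C₁ * rL) := by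
    rw [← ENNReal.ofReal_le_ofReal_iff (by positivity)]
    refine (htail k K M L (by omega) hK3 hKk).trans ?_
    rw [ENNReal.ofReal_add (by positivity) (by positivity), ENNReal.ofReal_mul (p := C) hC.le,
      ENNReal.ofReal_mul (p := C) (q := L * (C₁ * rK) + C₁ * rL) hC.le,
      ENNReal.ofReal_add (by positivity) (by positivity),
      ENNReal.ofReal_mul (p := (L : ℝ)) (by positivity), ENNReal.ofReal_natCast]
    gcongr
    · exact hrec K (by omega)
    · exact hrec L hL3
  rw [Real.norm_of_nonneg (show 0 ≤ tail μ 0 Y k from measureReal_nonneg),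
    Real.norm_of_nonneg hg0.le]
  have hLK : L * (C₁ * rK) ≤ 2 * (C₁ * (b ^ (ρ - 1) * (1 / 2) ^ (-α))) * g := by
    calc L * (C₁ * rK) ≤ 2 * x * (C₁ * (b ^ (ρ - 1) * (1 / 2) ^ (-α) *
          ((k : ℝ) ^ (1 - ρ) * l ^ (-α) * l ^ (ρ - 1)))) := by gcongr
      _ = 2 * (C₁ * (b ^ (ρ - 1) * (1 / 2) ^ (-α))) *
          ((k : ℝ) ^ (1 - ρ) * x * l ^ (-α) * l ^ (ρ - 1)) := by ring
      _ ≤ 2 * (C₁ * (b ^ (ρ - 1) * (1 / 2) ^ (-α))) * g := by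
          rw [hkx, hg]
          gcongr
  calc tail μ 0 Y k ≤ C * γ ^ M + C * (L * (C₁ * rK) + C₁ * rL) := hreal
    _ ≤ C * g + C * (2 * (C₁ * (b ^ (ρ - 1) * (1 / 2) ^ (-α))) * g + C₁ * (σ ^ (-α) * g)) := by
        gcongr
    _ = _ := by ring

end Asymptotics

end ReinforcedWalk

open ReinforcedWalk
theorem corollary18 {V Ω Ω' : Type*} [MeasurableSpace Ω] [MeasurableSpace Ω']
    -- an infinite tree of bounded degree
    (G : SimpleGraph V) (hG : G.IsTree) [Infinite V]
    (D : ℕ) (hD : ∀ v : V, (G.neighborSet v).encard ≤ D)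
    -- the reinforcement weight function
    (ρ : ℝ) (hρ : 1 < ρ) (w : ℕ → ℝ) (hw : IsPowerLogWeight ρ w)
    -- the walk on the tree, with unit initial weights, started at an arbitrary vertex at time 0
    (v₀ : V) (μ : Measure Ω) (I : ℕ → Ω → V) (Y : ℕ → Ω → G.edgeSet)
    (hY : IsERRW (simpleEnds G) w (fun _ => 1) v₀ μ I Y)
    -- the walk on the two-edge graph, with unit initial weights, started at time 1 + 1 = 2
    (ν : Measure Ω') (J : ℕ → Ω' → Fin 2) (Z : ℕ → Ω' → Bool)
    (hZ : IsERRW twoEdges w (fun _ => 1) 0 ν J Z)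
    (q : ℝ) (hq : ρ - (ρ - 1) / ρ < q) :
    (fun k : ℕ => tail μ 0 Y k) =O[atTop]
      (fun k : ℕ => tail ν 2 Z k * Real.log k ^ q) := by
  obtain ⟨α, hα, h1, hw'⟩ := hw.exists_exponent
  -- Hence `ρ - 1 ≤ ρ - (ρ - 1) / ρ < q`, which is what the tree bound asks of `q`.
  have hσ1 : (ρ - 1) / ρ ≤ 1 := by rw [div_le_one (by linarith)]; linarith
  exact (isBigO_tail_tree hG hD hρ hα h1 hw' hY (by linarith)).trans
    ((isBigO_tail_twoEdges hρ hα h1 hw' hZ).mul (isBigO_refl _ _))
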